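/- **Setting.** For $k\ge 1$ let $D_k$ be the $2^k\times 2^k$ matrix whose rows are indexed by the assignments $x\in\{\pm1\}^k$, whose columns are indexed by the multilinear monomials in $x_1,\dots,x_k$, and whose entries are the evaluations. Adding up the columns belonging to the monomials of each elementary symmetric polynomial $p_0,\dots,p_k$, and keeping one row for each class of assignments under permutations of the variables (class $i$ consists of the $\binom ki$ assignments with exactly $i$ entries $-1$), gives the $(k+1)\times(k+1)$ matrix $\tilde D_k$. Let $L=\mathrm{diag}\big(\sqrt{\tbinom ki}\big)_{0\le i\le k}$, and let $R$ be the diagonal matrix with positive entries that normalizes the columns of $L\tilde D_k$. The *squashed QFT* is $V_k=L\cdot\tilde D_k\cdot R$. For $y\in\mathbb Z$ let $c_k(y)=\binom{k}{(k+y)/2}$ if $-k\le y\le k$ and $y\equiv k \pmod 2$, and $c_k(y)=0$ otherwise. $\mathcal B(0,k)$ is the distribution with $\Pr[y]=c_k(y)/2^k$. A polynomial $Q$ in $n$ variables with $m\geq 1$ monomials is *specified* by a one-to-one function $h:[m]\to\{0,1\}^n$ if $Q=\sum_{z\in[m]}X_1^{h(z)_1}\cdots X_n^{h(z)_n}$.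 It is assumed to be homogeneous of degree $d\ge1$. Put $\mathrm{Var}=\mathrm{Var}[Q(X_1,\dots,X_n)]$ with $X_1,\dots,X_n$ independent and $\mathcal B(0,k)$-distributed. The *squashed distribution* is $$\Pr[y]=\frac{Q(y)^2\prod_{i=1}^n c_k(y_i)}{2^{kn}\,\mathrm{Var}},\qquad y\in[-k,k]^n$$ (and $\Pr[y]=0$ for all other $y\in\mathbb Z^n$). A *quantum circuit* is a product of unitaries on qubits, each acting on at most $b$ of the qubits, where $b$ is a constant; its running time is the number of factors. A qudit of dimension $k+1$ is written in binary on the least number of qubits that suffices, and circuits may use ancilla qubits that start and end in state $0$. **Theorem.** Let $(Q_i,h_i,n_i,m_i,d_i,k_i)_{i\in I}$ be any family of such data: $Q_i$ is homogeneous of degree $d_i\ge1$ in $n_i$ variables, has $m_i\ge1$ monomials and is specified by $h_i$, and $k_i\ge1$. 1. Each $V_{k_i}$ is unitary. 2. For each $i$, write $n=n_i$, $m=m_i$, $k=k_i$, $h=h_i$. If $V_k^{\otimes n}$ is applied to the state $\frac1{\sqrt m}\sum_{z\in[m]}|h(z)\rangle$ of $n$ qudits of dimension $k+1$, then for every $r\in\{0,\dots,k\}^n$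 the squared modulus of the amplitude of $|r\rangle$ is the squashed probability of $y=(k-2r_1,\dots,k-2r_n)$. 3. Suppose that - $h_i$ and its inverse on its image are efficiently computable (by Boolean circuits of size polynomial in $n_i$), - $k_i\le 2^{p(n_i)}$ for some polynomial $p$, and - $V_{k_i}$ is implemented by quantum circuits with a number of gates and of ancilla qubits polynomial in $n_i$. Then the squashed distributions can be sampled exactly and efficiently on a quantum computer, as follows. With a constant locality bound, and with numbers of gates and of ancilla qubits polynomial in $n_i$, there are a quantum circuit $P_i$ that prepares the state in 2 from the all-zero state and a quantum circuit $W_i$ that implements $V_{k_i}^{\otimes n_i}$. Applying $P_i$, then $W_i$, to the all-zero state, measuring all qubits in the standard basis and reading the number $r_j$ in the $j$-th register as $y_j=k_i-2r_j$ gives every $y\in\mathbb Z^{n_i}$ with exactly its squashed probability. -/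

import Mathlib

open scoped Matrix

/-! ### The squashed quantum Fourier transform -/

section SquashedQFT

/-- The `2^k × 2^k` matrix `D_k`: rows are the assignments in `{±1}^k` (here `ℤˣ = {1, -1}`),
columns are the multilinear monomials (subsets of the variables), entries are evaluations. -/
def monomialMatrix (k : ℕ) : Matrix (Fin k → ℤˣ) (Finset (Fin k)) ℝ :=
  Matrix.of fun x S => ∏ l ∈ S, ((x l : ℤ) : ℝ)

/-- The `2^k × (k+1)` matrix whose `j`-th column is the sum of the columns of `D_k` belonging to the
monomials of the `j`-th elementary symmetric polynomial. -/
noncomputable def symmetrizedColumns (k : ℕ) : Matrix (Fin k → ℤˣ) (Fin (k + 1)) ℝ :=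
  Matrix.of fun x j => ∑ S ∈ Finset.powersetCard (j : ℕ) Finset.univ, monomialMatrix k x S

/-- The `i`-th class of assignments under permutations of the variables:
those with exactly `i` entries equal to `-1`. -/
def assignmentClass (k i : ℕ) : Finset (Fin k → ℤˣ) :=
  Finset.univ.filter fun x => (Finset.univ.filter fun l => x l = -1).card = i

/-- A representative of the `i`-th class (`i ≤ k`): the first `i` entries are `-1`, the others `1`. -/
def classRepresentative (k i : ℕ) : Fin k → ℤˣ :=
  fun l => if (l : ℕ) < i then -1 else 1

/-- The `(k+1) × (k+1)` matrix `D̃_k`: one row is kept from each class of assignments. -/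
noncomputable def squashedMatrix (k : ℕ) : Matrix (Fin (k + 1)) (Fin (k + 1)) ℝ :=
  Matrix.of fun i j => symmetrizedColumns k (classRepresentative k i) j

/-- The diagonal matrix `L`, with `i`-th entry the square root of the size of the `i`-th class. -/
noncomputable def squashL (k : ℕ) : Matrix (Fin (k + 1)) (Fin (k + 1)) ℝ :=
  Matrix.diagonal fun i => Real.sqrt ((assignmentClass k i).card : ℝ)

/-- The diagonal matrix `R` that normalizes the columns of `L D̃_k`. -/
noncomputable def squashR (k : ℕ) : Matrix (Fin (k + 1)) (Fin (k + 1)) ℝ :=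
  Matrix.diagonal fun j => (Real.sqrt (∑ i, ((squashL k * squashedMatrix k) i j) ^ 2))⁻¹

/-- The squashed quantum Fourier transform `L D̃_k R`, as a complex matrix. -/
noncomputable def squashedQFT (k : ℕ) : Matrix (Fin (k + 1)) (Fin (k + 1)) ℂ :=
  (squashL k * squashedMatrix k * squashR k).map Complex.ofReal

/-- The `n`-fold tensor power of a matrix, acting on `n` qudits. -/
def tensorPower {κ : Type*} (n : ℕ) (V : Matrix κ κ ℂ) : Matrix (Fin n → κ) (Fin n → κ) ℂ :=
  Matrix.of fun r s => ∏ i, V (r i) (s i)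

end SquashedQFT

/-! ### The polynomial, the binomial distribution and the squashed distribution -/

section Distribution

/-- The number of assignments in `{±1}^k` with coordinate sum `y`: the binomial coefficient
`C(k, (k+y)/2)` if `y ∈ [-k,k]` has the parity of `k`, and `0` otherwise. -/
def orbitSize (k : ℕ) (y : ℤ) : ℕ :=
  if -(k : ℤ) ≤ y ∧ y ≤ k ∧ (2 : ℤ) ∣ k + y then k.choose (((k : ℤ) + y) / 2).toNat else 0

/-- The distribution `B(0,k)`, as a measure on `ℝ`. -/
noncomputable def centeredBinomial (k : ℕ) : MeasureTheory.Measure ℝ :=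
  ∑ y ∈ Finset.Icc (-(k : ℤ)) k,
    ENNReal.ofReal ((orbitSize k y : ℝ) / 2 ^ k) • MeasureTheory.Measure.dirac (y : ℝ)

/-- The variance of `Q(X₁, …, X_n)` for independent `X_i` with distribution `B(0,k)`. -/
noncomputable def polynomialVariance {n : ℕ} (k : ℕ) (Q : MvPolynomial (Fin n) ℝ) : ℝ :=
  ProbabilityTheory.variance (fun x : Fin n → ℝ => MvPolynomial.eval x Q)
    (MeasureTheory.Measure.pi fun _ : Fin n => centeredBinomial k)

/-- The squashed distribution: the probability of `y`. -/
noncomputable def squashedProb {n : ℕ} (k : ℕ) (Q : MvPolynomial (Fin n) ℝ) (y : Fin n → ℤ) : ℝ :=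
  MvPolynomial.eval (fun i => (y i : ℝ)) Q ^ 2 * (∏ i, (orbitSize k (y i) : ℝ)) /
    (2 ^ (k * n) * polynomialVariance k Q)

/-- `Q` is the sum of the `m` distinct multilinear monomials with exponent vectors `h(z)`. -/
def IsSpecifiedBy {n m : ℕ} (Q : MvPolynomial (Fin n) ℝ) (h : Fin m → Fin n → Bool) : Prop :=
  Function.Injective h ∧ Q = ∑ z, ∏ i, MvPolynomial.X i ^ (h z i).toNat

/-- The state `m^{-1/2} ∑_z |h(z)⟩` of `n` qudits of dimension `k + 1`; the bits `0`, `1` of `h(z)`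
are the basis states `|0⟩`, `|1⟩`. -/
noncomputable def monomialState {n m : ℕ} (k : ℕ) (h : Fin m → Fin n → Bool) :
    (Fin n → Fin (k + 1)) → ℂ :=
  fun r => (((Real.sqrt m)⁻¹ : ℝ) : ℂ) *
    ∑ z, if ∀ i, (r i : ℕ) = (h z i).toNat then 1 else 0

end Distribution

/-! ### Boolean circuits -/

section BooleanCircuits

/-- A straight-line program of NAND gates with `a` inputs and `b` outputs. Wires `0, …, a-1` carry
the input; the `s`-th gate `(i, j)` puts the NAND of wires `i` and `j` on wire `a + s`. -/
structure BoolCircuit (a b : ℕ) where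
  gates : List (ℕ × ℕ)
  output : Fin b → ℕ

/-- The number of gates. -/
def BoolCircuit.size {a b : ℕ} (C : BoolCircuit a b) : ℕ := C.gates.length

/-- The function computed by a circuit (a wire that has not been written carries `false`). -/
def BoolCircuit.eval {a b : ℕ} (C : BoolCircuit a b) (x : Fin a → Bool) : Fin b → Bool :=
  fun o =>
    (C.gates.foldl (fun wires g =>
        wires ++ [!(wires.getD g.1 false && wires.getD g.2 false)]) (List.ofFn x)).getD
      (C.output o) false

/-- The `t` low-order binary digits of `j`. -/
def binary (t j : ℕ) : Fin t → Bool := fun q => j.testBit q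

/-- The functions `h_i : [m_i] → {0,1}^{n_i}` and their inverses on their images are computed by
Boolean circuits of size polynomial in `n_i`. An index `z ∈ [m_i]` is written with `n_i` binary digits
(`m_i ≤ 2^{n_i}` since `h_i` is one-to-one). -/
def EfficientlyInvertible {I : Type*} (n m : I → ℕ) (h : ∀ i, Fin (m i) → Fin (n i) → Bool) : Prop :=
  ∃ p : Polynomial ℕ, ∀ i, ∃ C C' : BoolCircuit (n i) (n i),
    C.size ≤ p.eval (n i) ∧ C'.size ≤ p.eval (n i) ∧
    (∀ z : Fin (m i), C.eval (binary (n i) z) = h i z) ∧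
    (∀ z : Fin (m i), C'.eval (h i z) = binary (n i) z)

end BooleanCircuits

/-! ### Quantum circuits -/

section QuantumCircuits

variable {ι : Type*} [Fintype ι] [DecidableEq ι]

/-- A standard basis vector of the space of qubits labelled by `ι`. -/
def ket (x : ι → Bool) : (ι → Bool) → ℂ := Pi.single x 1

open Classical in
/-- A local unitary: a unitary on at most `b` of the qubits, tensored with the identity. -/
def IsLocalUnitary (b : ℕ) (A : Matrix (ι → Bool) (ι → Bool) ℂ) : Prop :=
  ∃ c ≤ b, ∃ e : Fin c ↪ ι, ∃ U ∈ Matrix.unitaryGroup (Fin c → Bool) ℂ,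
    A = Matrix.of fun x y =>
      if ∀ q, q ∉ Set.range e → x q = y q then U (x ∘ e) (y ∘ e) else 0

/-- `A` is a product of at most `s` unitaries, each of which acts on at most `b` qubits. -/
def HasLocalDecomposition (b s : ℕ) (A : Matrix (ι → Bool) (ι → Bool) ℂ) : Prop :=
  ∃ l : List (Matrix (ι → Bool) (ι → Bool) ℂ),
    l.length ≤ s ∧ (∀ B ∈ l, IsLocalUnitary b B) ∧ l.prod = A

/-- `A` acts as `V` on the basis states `|E j⟩` that encode the logical basis states `j`. -/
def Implements {κ : Type*} [Fintype κ] (E : κ → ι → Bool) (V : Matrix κ κ ℂ)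
    (A : Matrix (ι → Bool) (ι → Bool) ℂ) : Prop :=
  ∀ j, A *ᵥ ket (E j) = ∑ i, V i j • ket (E i)

/-- A basis state of one `(k+1)`-dimensional qudit, written in binary on `Nat.size k` qubits (the
least number `t` with `k < 2^t`) next to `a` ancilla qubits in state `0`. -/
def encodeQudit (k a : ℕ) (j : Fin (k + 1)) : Fin k.size ⊕ Fin a → Bool :=
  Sum.elim (binary k.size j) (fun _ => false)

/-- A basis state of `n` qudits of dimension `k+1`, each written in binary on its own `Nat.size k`
qubits, next to `a` ancilla qubits in state `0`. -/
def encodeQudits (n k a : ℕ) (r : Fin n → Fin (k + 1)) : (Fin n × Fin k.size) ⊕ Fin a → Bool :=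
  Sum.elim (fun q => binary k.size (r q.1) q.2) (fun _ => false)

/-- The squashed transforms of sizes `k_i + 1` have quantum circuits with polynomially many (in `n_i`)
local gates, using polynomially many ancilla qubits, which are returned to `0`. -/
def SquashedQFTEfficient {I : Type*} (n k : I → ℕ) : Prop :=
  ∃ (b : ℕ) (p : Polynomial ℕ), ∀ i, ∃ a ≤ p.eval (n i),
    ∃ A : Matrix (Fin (k i).size ⊕ Fin a → Bool) (Fin (k i).size ⊕ Fin a → Bool) ℂ,
      HasLocalDecomposition b (p.eval (n i)) A ∧
      Implements (encodeQudit (k i) a) (squashedQFT (k i)) A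

/-- The point of `ℤⁿ` named by a measured bit string: if the `i`-th register holds the number `c`, the
index of the class of assignments with `c` entries `-1`, then the `i`-th coordinate is the
coordinate sum `k - 2c` of such an assignment. -/
def outcome (n k a : ℕ) (x : (Fin n × Fin k.size) ⊕ Fin a → Bool) : Fin n → ℤ :=
  fun i => (k : ℤ) - 2 * (Nat.ofBits fun q : Fin k.size => x (Sum.inl (i, q)) : ℕ)

/-- The probability of obtaining `y` when all qubits are measured in the standard basis after `A` has
been applied to the all-zero state. -/
noncomputable def outcomeProb (n k a : ℕ)
    (A : Matrix ((Fin n × Fin k.size) ⊕ Fin a → Bool) ((Fin n × Fin k.size) ⊕ Fin a → Bool) ℂ)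
    (y : Fin n → ℤ) : ℝ :=
  ∑ x ∈ Finset.univ.filter (fun x => outcome n k a x = y), ‖(A *ᵥ ket (fun _ => false)) x‖ ^ 2

end QuantumCircuits

/-!
The squashed matrix `D̃_k` satisfies `∑ i, k.choose i * D̃ i j * D̃ i j' = 2 ^ k * k.choose j` if
`j = j'` and `0` otherwise, because the columns of `D_k` are the orthogonal characters of `{±1}^k`;
this makes `V_k` unitary. Its first two columns are multiples of the degree `0` and `1` polynomials
in `k - 2 * r`, so the amplitudes of `V_k^{⊗n}` on the superposition of the exponent vectors `h z`
are `Q` times the root of the binomial weight. As the moments of order at most two of `B(0,k)` are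
those of a centered variable of variance `k`, distinct multilinear monomials of degree `d ≥ 1` are
centered and orthogonal, and `Var = m * k ^ d`.

The uniform superposition of `0, …, m - 1` is prepared by running a comparator backwards: the
two-state automaton that compares a binary number with `m - 1` from the lowest to the highest bit
ends in the state `false` exactly on these numbers. Starting from that final state, one two-qubit
gate per bit splits every branch into the pairs of preceding state and bit read, weighted by the
number of words that lead there. The initial state is the same for all words, so the flag qubit that
carries the state is clean at the end. Then `h` is evaluated reversibly (compute, copy, uncompute),
and the index is erased by the adjoint of the circuit that recomputes it from `h z`.
-/

/-! ### Unitarity -/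

theorem monomialMatrix_transpose_mul_self (k : ℕ) :
    (monomialMatrix k)ᵀ * monomialMatrix k = (2 ^ k : ℝ) • 1 := by
  ext S T
  have column_mul (x : Fin k → ℤˣ) : monomialMatrix k x S * monomialMatrix k x T =
      ∏ l, ((if l ∈ S then ((x l : ℤ) : ℝ) else 1) * (if l ∈ T then ((x l : ℤ) : ℝ) else 1)) := by
    simp only [monomialMatrix, Matrix.of_apply, Finset.prod_mul_distrib, Finset.prod_ite_mem,
      Finset.univ_inter]
  have sum_units (l : Fin k) : ∑ u : ℤˣ, (if l ∈ S then ((u : ℤ) : ℝ) else 1) *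
      (if l ∈ T then ((u : ℤ) : ℝ) else 1) = if (l ∈ S ↔ l ∈ T) then 2 else 0 := by
    rw [UnitsInt.univ, Finset.sum_pair (by decide)]
    by_cases hS : l ∈ S <;> by_cases hT : l ∈ T <;> simp [hS, hT] <;> norm_num
  rw [Matrix.mul_apply, Matrix.smul_apply, Matrix.one_apply]
  simp only [Matrix.transpose_apply, column_mul]
  rw [← Fintype.piFinset_univ, ← Finset.prod_univ_sum (fun _ => Finset.univ) fun l (u : ℤˣ) =>
    (if l ∈ S then ((u : ℤ) : ℝ) else 1) * (if l ∈ T then ((u : ℤ) : ℝ) else 1)]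
  simp only [sum_units]
  split_ifs with h
  · simp [h]
  · obtain ⟨l, hl⟩ := not_forall.1 (mt Finset.ext h)
    rw [Finset.prod_eq_zero (Finset.mem_univ l) (if_neg hl), smul_zero]

theorem symmetrizedColumns_transpose_mul_self (k : ℕ) :
    (symmetrizedColumns k)ᵀ * symmetrizedColumns k =
      Matrix.diagonal fun j : Fin (k + 1) => 2 ^ k * (k.choose j : ℝ) := by
  ext j l
  have sum_monomial (S T : Finset (Fin k)) :
      ∑ x, monomialMatrix k x S * monomialMatrix k x T = if S = T then 2 ^ k else 0 := by
    simpa [Matrix.mul_apply, Matrix.one_apply] using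
      congrFun (congrFun (monomialMatrix_transpose_mul_self k) S) T
  simp only [Matrix.mul_apply, Matrix.transpose_apply, symmetrizedColumns, Matrix.of_apply,
    Finset.sum_mul_sum, Matrix.diagonal_apply]
  rw [Finset.sum_comm]
  simp_rw [Finset.sum_comm (s := Finset.univ), sum_monomial, Finset.sum_ite_eq]
  split_ifs with h
  · subst h
    rw [Finset.sum_congr rfl fun S hS => if_pos hS]
    simp [mul_comm]
  · refine Finset.sum_eq_zero fun S hS => if_neg fun hS' => h ?_
    rw [Finset.mem_powersetCard] at hS hS'
    exact Fin.ext (hS.2.symm.trans hS'.2)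

/-- The number of entries `-1` of an assignment, which determines its class under permutations of
the variables. -/
def minusCount {k : ℕ} (x : Fin k → ℤˣ) : ℕ := (Finset.univ.filter fun l => x l = -1).card

theorem minusCount_le {k : ℕ} (x : Fin k → ℤˣ) : minusCount x ≤ k := by
  simpa [minusCount] using Finset.card_filter_le Finset.univ fun l => x l = -1

theorem mem_assignmentClass {k i : ℕ} {x : Fin k → ℤˣ} :
    x ∈ assignmentClass k i ↔ minusCount x = i := by
  simp [assignmentClass, minusCount]

theorem minusCount_classRepresentative {k i : ℕ} (hi : i ≤ k) :
    minusCount (classRepresentative k i) = i := by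
  have (l : Fin k) : classRepresentative k i l = -1 ↔ (l : ℕ) < i := by
    unfold classRepresentative
    split_ifs with h <;> simp [h]
  simp only [minusCount, this]
  rw [Fin.card_filter_val_lt, min_eq_right hi]

open Polynomial in
theorem symmetrizedColumns_eq_coeff {k : ℕ} (x : Fin k → ℤˣ) (j : Fin (k + 1)) :
    symmetrizedColumns k x j =
      ((1 - X : ℝ[X]) ^ minusCount x * (1 + X) ^ (k - minusCount x)).coeff j := by
  have prod_eq : ∏ l, (1 + X * C ((x l : ℤ) : ℝ)) =
      (1 - X : ℝ[X]) ^ minusCount x * (1 + X) ^ (k - minusCount x) := by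
    have factor (l : Fin k) : (1 + X * C ((x l : ℤ) : ℝ)) =
        if x l = -1 then (1 - X : ℝ[X]) else 1 + X := by
      rcases Int.units_eq_one_or (x l) with h | h <;> simp [h, sub_eq_add_neg]
    rw [Finset.prod_congr rfl fun l _ => factor l, Finset.prod_ite, Finset.prod_const,
      Finset.prod_const, Finset.filter_not, Finset.card_univ_sdiff, Fintype.card_fin, minusCount]
  rw [← prod_eq, Finset.prod_one_add, finsetSum_coeff]
  simp only [Finset.prod_mul_distrib, Finset.prod_const, ← map_prod, coeff_mul_C, coeff_X_pow,
    ite_mul, one_mul, zero_mul, ← Finset.sum_filter, symmetrizedColumns, monomialMatrix,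
    Matrix.of_apply, Finset.powersetCard_eq_filter, eq_comm]

theorem symmetrizedColumns_eq_squashedMatrix {k : ℕ} {x : Fin k → ℤˣ} {i : Fin (k + 1)}
    (hx : minusCount x = i) (j : Fin (k + 1)) :
    symmetrizedColumns k x j = squashedMatrix k i j := by
  rw [squashedMatrix, Matrix.of_apply, symmetrizedColumns_eq_coeff, symmetrizedColumns_eq_coeff,
    minusCount_classRepresentative i.is_le, hx]

theorem card_assignmentClass (k i : ℕ) : (assignmentClass k i).card = k.choose i := by
  have card_powersetCard : (Finset.powersetCard i (Finset.univ : Finset (Fin k))).card =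
      k.choose i := by
    rw [Finset.card_powersetCard, Finset.card_univ, Fintype.card_fin]
  rw [← card_powersetCard]
  refine Finset.card_bij' (fun x _ => Finset.univ.filter fun l => x l = -1)
    (fun S _ l => if l ∈ S then -1 else 1) ?_ ?_ ?_ ?_
  · intro x hx
    simpa [assignmentClass, Finset.mem_powersetCard] using hx
  · intro S hS
    have (l : Fin k) : (if l ∈ S then -1 else 1 : ℤˣ) = -1 ↔ l ∈ S := by
      split_ifs with h <;> simp [h]
    simpa [assignmentClass, this, Finset.mem_powersetCard] using hS
  · intro x _
    funext l
    rcases Int.units_eq_one_or (x l) with h | h <;> simp [h]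
  · intro S _
    ext l
    by_cases h : l ∈ S <;> simp [h]

theorem sum_choose_mul_squashedMatrix_mul (k : ℕ) (j l : Fin (k + 1)) :
    ∑ i : Fin (k + 1), (k.choose i : ℝ) * (squashedMatrix k i j * squashedMatrix k i l) =
      if j = l then 2 ^ k * (k.choose j : ℝ) else 0 := by
  let level (x : Fin k → ℤˣ) : Fin (k + 1) := ⟨minusCount x, Nat.lt_succ_of_le (minusCount_le x)⟩
  have fiber (i : Fin (k + 1)) : (Finset.univ.filter fun x => level x = i) =
      assignmentClass k i := by
    ext x
    simp [level, mem_assignmentClass, Fin.ext_iff]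
  have gram := congrFun (congrFun (symmetrizedColumns_transpose_mul_self k) j) l
  rw [Matrix.mul_apply, Matrix.diagonal_apply, ← Finset.sum_fiberwise _ level] at gram
  rw [← gram]
  refine Finset.sum_congr rfl fun i _ => ?_
  rw [fiber, Finset.sum_congr rfl fun x hx => by
    rw [Matrix.transpose_apply, symmetrizedColumns_eq_squashedMatrix (mem_assignmentClass.1 hx),
      symmetrizedColumns_eq_squashedMatrix (mem_assignmentClass.1 hx)],
    Finset.sum_const, card_assignmentClass, nsmul_eq_mul]

theorem squashL_mul_squashedMatrix_apply (k : ℕ) (i j : Fin (k + 1)) :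
    (squashL k * squashedMatrix k) i j = √(k.choose i) * squashedMatrix k i j := by
  rw [squashL, Matrix.diagonal_mul, card_assignmentClass]

theorem squashL_mul_squashedMatrix_transpose_mul_self (k : ℕ) :
    (squashL k * squashedMatrix k)ᵀ * (squashL k * squashedMatrix k) =
      Matrix.diagonal fun j : Fin (k + 1) => 2 ^ k * (k.choose j : ℝ) := by
  ext j l
  rw [Matrix.mul_apply, Matrix.diagonal_apply, ← sum_choose_mul_squashedMatrix_mul]
  refine Finset.sum_congr rfl fun i _ => ?_
  rw [Matrix.transpose_apply, squashL_mul_squashedMatrix_apply, squashL_mul_squashedMatrix_apply,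
    mul_mul_mul_comm, Real.mul_self_sqrt (Nat.cast_nonneg _)]

theorem squashR_eq (k : ℕ) :
    squashR k = Matrix.diagonal fun j : Fin (k + 1) => (√(2 ^ k * (k.choose j : ℝ)))⁻¹ := by
  have column_norm (j : Fin (k + 1)) :=
    congrFun (congrFun (squashL_mul_squashedMatrix_transpose_mul_self k) j) j
  simp only [Matrix.mul_apply (M := (squashL k * squashedMatrix k)ᵀ), Matrix.transpose_apply,
    ← sq, Matrix.diagonal_apply_eq] at column_norm
  simp only [squashR, column_norm]

theorem squashedQFT_apply (k : ℕ) (i j : Fin (k + 1)) :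
    squashedQFT k i j =
      ((√(k.choose i) * squashedMatrix k i j * (√(2 ^ k * (k.choose j : ℝ)))⁻¹ : ℝ) : ℂ) := by
  rw [squashedQFT, Matrix.map_apply, squashR_eq, Matrix.mul_diagonal,
    squashL_mul_squashedMatrix_apply]

theorem squashedQFT_mem_unitaryGroup (k : ℕ) :
    squashedQFT k ∈ Matrix.unitaryGroup (Fin (k + 1)) ℂ := by
  set V : Matrix (Fin (k + 1)) (Fin (k + 1)) ℝ := squashL k * squashedMatrix k * squashR k with hV
  have orthogonal : Vᵀ * V = 1 := by
    rw [hV, Matrix.transpose_mul, Matrix.mul_assoc, ← Matrix.mul_assoc _ _ (squashR k),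
      squashL_mul_squashedMatrix_transpose_mul_self, squashR_eq, Matrix.diagonal_transpose,
      Matrix.diagonal_mul_diagonal, Matrix.diagonal_mul_diagonal, ← Matrix.diagonal_one]
    congr 1
    funext j
    have hpos : (0 : ℝ) < 2 ^ k * (k.choose j : ℝ) :=
      mul_pos (by positivity) (by exact_mod_cast Nat.choose_pos j.is_le)
    rw [mul_comm, mul_assoc, ← mul_inv, Real.mul_self_sqrt hpos.le, mul_inv_cancel₀ hpos.ne']
  rw [Matrix.mem_unitaryGroup_iff', Matrix.star_eq_conjTranspose,
    show squashedQFT k = V.map Complex.ofRealHom from rfl,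
    ← Matrix.conjTranspose_map Complex.ofRealHom fun r => (Complex.conj_ofReal r).symm,
    ← Matrix.map_mul,
    Matrix.conjTranspose_eq_transpose_of_trivial, orthogonal,
    Matrix.map_one _ (map_zero _) (map_one _)]

theorem squashedMatrix_zero (k : ℕ) (i : Fin (k + 1)) : squashedMatrix k i 0 = 1 := by
  simp [squashedMatrix, symmetrizedColumns, monomialMatrix]

theorem squashedMatrix_one {k : ℕ} (hk : 0 < k) (i : Fin (k + 1)) :
    squashedMatrix k i ⟨1, Nat.succ_lt_succ hk⟩ = (k : ℝ) - 2 * (i : ℕ) := by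
  have entry (l : Fin k) : ((classRepresentative k i l : ℤ) : ℝ) =
      1 - 2 * (if classRepresentative k i l = -1 then 1 else 0) := by
    rcases Int.units_eq_one_or (classRepresentative k i l) with h | h <;> rw [h] <;> norm_num
  calc squashedMatrix k i ⟨1, Nat.succ_lt_succ hk⟩
      = ∑ l : Fin k, ((classRepresentative k i l : ℤ) : ℝ) := by
        simp [squashedMatrix, symmetrizedColumns, monomialMatrix, Finset.powersetCard_one]
    _ = k - 2 * (minusCount (classRepresentative k i) : ℝ) := by
        simp only [entry, Finset.sum_sub_distrib, ← Finset.mul_sum, Finset.sum_boole, minusCount]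
        simp
    _ = (k : ℝ) - 2 * (i : ℕ) := by rw [minusCount_classRepresentative i.is_le]

/-- The basis state `|0⟩` or `|1⟩` of a qudit of dimension `k + 1 ≥ 2` that stands for a bit. -/
def bitLevel {k : ℕ} (hk : 0 < k) (b : Bool) : Fin (k + 1) := ⟨b.toNat, by cases b <;> simp [hk]⟩

theorem squashedMatrix_bitLevel {k : ℕ} (hk : 0 < k) (i : Fin (k + 1)) (b : Bool) :
    squashedMatrix k i (bitLevel hk b) = ((k : ℝ) - 2 * (i : ℕ)) ^ b.toNat := by
  cases b
  · simpa [bitLevel] using squashedMatrix_zero k i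
  · simpa [bitLevel] using squashedMatrix_one hk i

/-! ### The variance of the polynomial -/

theorem orbitSize_sub_two_mul {k r : ℕ} (hr : r ≤ k) :
    orbitSize k ((k : ℤ) - 2 * r) = k.choose r := by
  rw [orbitSize, if_pos ⟨by omega, by omega, by omega⟩,
    show (((k : ℤ) + (k - 2 * r)) / 2).toNat = k - r by omega, Nat.choose_symm hr]

theorem exists_eq_sub_two_mul_of_orbitSize_ne_zero {k : ℕ} {y : ℤ} (hy : orbitSize k y ≠ 0) :
    ∃ r : Fin (k + 1), y = (k : ℤ) - 2 * (r : ℕ) := by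
  obtain ⟨_, _, c, hc⟩ := of_not_not fun h => hy (if_neg h)
  exact ⟨⟨((k - y) / 2).toNat, by omega⟩, by simp only; omega⟩

theorem sum_Icc_orbitSize_mul (k : ℕ) (g : ℤ → ℝ) :
    ∑ y ∈ Finset.Icc (-(k : ℤ)) k, (orbitSize k y : ℝ) * g y =
      ∑ r : Fin (k + 1), (k.choose r : ℝ) * g (k - 2 * (r : ℕ)) := by
  refine (Finset.sum_of_injOn (fun r : Fin (k + 1) => (k : ℤ) - 2 * (r : ℕ)) ?_ ?_ ?_ ?_).symm
  · intro r _ s _ h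
    simp only at h
    exact Fin.ext (by omega)
  · intro r _
    have := r.is_le
    simp only [Finset.coe_Icc, Set.mem_Icc]
    omega
  · intro y _ hy
    by_contra hne
    obtain ⟨r, rfl⟩ := exists_eq_sub_two_mul_of_orbitSize_ne_zero (k := k) (y := y)
      fun h0 => hne (by simp [h0])
    exact hy ⟨r, by simp, rfl⟩
  · intro r _
    simp only [orbitSize_sub_two_mul r.is_le]

theorem integrable_centeredBinomial (k : ℕ) (f : ℝ → ℝ) :
    MeasureTheory.Integrable f (centeredBinomial k) := by
  unfold centeredBinomial
  rw [MeasureTheory.integrable_finsetSum_measure]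
  exact fun y _ =>
    (MeasureTheory.integrable_dirac (by simp)).smul_measure ENNReal.ofReal_ne_top

theorem integral_centeredBinomial (k : ℕ) (f : ℝ → ℝ) :
    ∫ x, f x ∂centeredBinomial k =
      (∑ r : Fin (k + 1), (k.choose r : ℝ) * f ((k : ℝ) - 2 * (r : ℕ))) / 2 ^ k := by
  have sum_levels := sum_Icc_orbitSize_mul k fun y => f y
  push_cast at sum_levels
  rw [← sum_levels, centeredBinomial, MeasureTheory.integral_finsetSum_measure, Finset.sum_div]
  · refine Finset.sum_congr rfl fun y _ => ?_
    rw [MeasureTheory.integral_smul_measure, MeasureTheory.integral_dirac,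
      ENNReal.toReal_ofReal (by positivity), smul_eq_mul]
    ring
  · exact fun y _ =>
      (MeasureTheory.integrable_dirac (by simp)).smul_measure ENNReal.ofReal_ne_top

instance isFiniteMeasure_centeredBinomial (k : ℕ) :
    MeasureTheory.IsFiniteMeasure (centeredBinomial k) := by
  simpa using
    (MeasureTheory.integrable_const_iff (c := (1 : ℝ))).1 (integrable_centeredBinomial k fun _ => 1)

-- The functions `1` and `x` are the columns `0` and `1` of `D̃_k`, which are orthogonal.
theorem integral_pow_mul_pow_centeredBinomial {k : ℕ} (hk : 0 < k) (b c : Bool) :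
    ∫ x, x ^ b.toNat * x ^ c.toNat ∂centeredBinomial k =
      if b = c then (k : ℝ) ^ b.toNat else 0 := by
  rw [integral_centeredBinomial k fun x => x ^ b.toNat * x ^ c.toNat]
  simp only [← squashedMatrix_bitLevel hk, sum_choose_mul_squashedMatrix_mul]
  cases b <;> cases c <;> simp [bitLevel]

section Polynomial

open MeasureTheory

theorem integrable_monomial_mul_monomial {n k : ℕ} (u v : Fin n → Bool) :
    Integrable (fun x : Fin n → ℝ => (∏ i, x i ^ (u i).toNat) * ∏ i, x i ^ (v i).toNat)
      (Measure.pi fun _ => centeredBinomial k) := by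
  simp only [← Finset.prod_mul_distrib]
  exact Integrable.fintype_prod (f := fun i x => x ^ (u i).toNat * x ^ (v i).toNat)
    fun i => integrable_centeredBinomial k _

theorem integral_monomial_mul_monomial {n k : ℕ} (hk : 0 < k) (u v : Fin n → Bool) :
    ∫ x : Fin n → ℝ, (∏ i, x i ^ (u i).toNat) * ∏ i, x i ^ (v i).toNat
      ∂(Measure.pi fun _ => centeredBinomial k) =
      if u = v then (k : ℝ) ^ ∑ i, (u i).toNat else 0 := by
  simp only [← Finset.prod_mul_distrib]
  rw [integral_fintype_prod_eq_prod (fun i x => x ^ (u i).toNat * x ^ (v i).toNat)]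
  simp only [integral_pow_mul_pow_centeredBinomial hk]
  split_ifs with h
  · simp [h, Finset.prod_pow_eq_pow_sum]
  · obtain ⟨i, hi⟩ := Function.ne_iff.1 h
    exact Finset.prod_eq_zero (Finset.mem_univ i) (if_neg hi)

variable {n m d : ℕ} {Q : MvPolynomial (Fin n) ℝ} {h : Fin m → Fin n → Bool}

theorem IsSpecifiedBy.eval_eq (hQ : IsSpecifiedBy Q h) (x : Fin n → ℝ) :
    MvPolynomial.eval x Q = ∑ z, ∏ i, x i ^ (h z i).toNat := by
  simp [hQ.2]

theorem IsSpecifiedBy.sum_toNat_eq (hQ : IsSpecifiedBy Q h) (hhom : Q.IsHomogeneous d)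
    (z : Fin m) : ∑ i, (h z i).toNat = d := by
  let exponent (z : Fin m) : Fin n →₀ ℕ :=
    Finsupp.equivFunOnFinite.symm fun i => (h z i).toNat
  have toNat_injective : Function.Injective Bool.toNat := by decide
  have exponent_injective : Function.Injective exponent := fun z w hzw =>
    hQ.1 <| funext fun i => toNat_injective (DFunLike.congr_fun hzw i)
  have eq_sum : Q = ∑ z, MvPolynomial.monomial (exponent z) 1 := by
    rw [hQ.2]
    refine Finset.sum_congr rfl fun z _ => ?_
    rw [MvPolynomial.monomial_eq, Finsupp.prod_fintype _ _ (by simp)]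
    simp [exponent]
  have coeff_ne_zero : Q.coeff (exponent z) ≠ 0 := by
    rw [eq_sum, MvPolynomial.coeff_sum]
    simp [MvPolynomial.coeff_monomial, exponent_injective.eq_iff]
  have weight_eq := hhom coeff_ne_zero
  rw [Finsupp.weight_apply, Finsupp.sum_fintype _ _ (by simp)] at weight_eq
  simpa [exponent] using weight_eq

variable {k : ℕ}

theorem IsSpecifiedBy.integral_eval_eq_zero (hQ : IsSpecifiedBy Q h) (hhom : Q.IsHomogeneous d)
    (hd : 0 < d) (hk : 0 < k) :
    ∫ x, MvPolynomial.eval x Q ∂(Measure.pi fun _ : Fin n => centeredBinomial k) = 0 := by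
  have integrable (z : Fin m) :=
    integrable_monomial_mul_monomial (k := k) (h z) fun _ => false
  have integral_eq (z : Fin m) := integral_monomial_mul_monomial hk (h z) fun _ => false
  simp only [Bool.toNat_false, pow_zero, Finset.prod_const_one, mul_one] at integrable integral_eq
  simp only [hQ.eval_eq]
  rw [integral_finsetSum _ fun z _ => integrable z]
  refine Finset.sum_eq_zero fun z _ => ?_
  have degree_eq := hQ.sum_toNat_eq hhom z
  rw [integral_eq, if_neg]
  rintro h_zero
  simp only [h_zero, Bool.toNat_false, Finset.sum_const_zero] at degree_eq
  exact hd.ne degree_eq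

theorem IsSpecifiedBy.polynomialVariance_eq (hQ : IsSpecifiedBy Q h) (hhom : Q.IsHomogeneous d)
    (hd : 0 < d) (hk : 0 < k) : polynomialVariance k Q = m * (k : ℝ) ^ d := by
  rw [polynomialVariance, ProbabilityTheory.variance_of_integral_eq_zero
    (MvPolynomial.continuous_eval Q).measurable.aemeasurable
    (hQ.integral_eval_eq_zero hhom hd hk)]
  simp only [hQ.eval_eq, sq, Finset.sum_mul_sum]
  rw [integral_finsetSum _ fun z _ => integrable_finsetSum _ fun w _ =>
    integrable_monomial_mul_monomial (h z) (h w)]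
  simp only [integral_finsetSum _ fun w _ => integrable_monomial_mul_monomial _ (h w),
    integral_monomial_mul_monomial hk, hQ.1.eq_iff, Finset.sum_ite_eq, Finset.mem_univ, if_true,
    hQ.sum_toNat_eq hhom]
  simp

end Polynomial

/-! ### The amplitudes -/

section Amplitudes

variable {n m k d : ℕ} {Q : MvPolynomial (Fin n) ℝ} {h : Fin m → Fin n → Bool}

theorem monomialState_eq (hk : 0 < k) (h : Fin m → Fin n → Bool) :
    monomialState k h =
      (((√m)⁻¹ : ℝ) : ℂ) • ∑ z, Pi.single (fun i => bitLevel hk (h z i)) 1 := by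
  funext r
  simp [monomialState, Finset.sum_apply, Pi.single_apply, funext_iff, bitLevel, Fin.ext_iff]

theorem squashedQFT_apply_bitLevel (hk : 0 < k) (r : Fin (k + 1)) (b : Bool) :
    squashedQFT k r (bitLevel hk b) =
      ((√(k.choose r / 2 ^ k) * (((k : ℝ) - 2 * (r : ℕ)) / √k) ^ b.toNat : ℝ) : ℂ) := by
  rw [squashedQFT_apply, squashedMatrix_bitLevel, Real.sqrt_div (Nat.cast_nonneg _),
    Real.sqrt_mul (by positivity)]
  cases b
  · simp [bitLevel, div_eq_mul_inv]
  · simp only [bitLevel, Bool.toNat_true, Nat.choose_one_right, pow_one]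
    congr 1
    field_simp

theorem IsSpecifiedBy.tensorPower_mulVec_monomialState (hQ : IsSpecifiedBy Q h)
    (hhom : Q.IsHomogeneous d) (hk : 0 < k) (r : Fin n → Fin (k + 1)) :
    (tensorPower n (squashedQFT k) *ᵥ monomialState k h) r =
      (((∏ i, √(k.choose (r i) / 2 ^ k)) *
        MvPolynomial.eval (fun i => (k : ℝ) - 2 * (r i : ℕ)) Q / (√m * √k ^ d) : ℝ) : ℂ) := by
  have prod_factor (z : Fin m) :
      ∏ i, (√(k.choose (r i) / 2 ^ k) * (((k : ℝ) - 2 * (r i : ℕ)) / √k) ^ (h z i).toNat) =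
        (∏ i, √(k.choose (r i) / 2 ^ k)) *
          ((∏ i, ((k : ℝ) - 2 * (r i : ℕ)) ^ (h z i).toNat) / √k ^ d) := by
    simp only [Finset.prod_mul_distrib, div_pow, Finset.prod_div_distrib,
      Finset.prod_pow_eq_pow_sum, hQ.sum_toNat_eq hhom]
  rw [monomialState_eq hk, Matrix.mulVec_smul, Matrix.mulVec_sum, Pi.smul_apply, Finset.sum_apply]
  simp only [Matrix.mulVec_single_one, Matrix.col_apply, tensorPower, Matrix.of_apply,
    squashedQFT_apply_bitLevel, ← Complex.ofReal_prod, ← Complex.ofReal_sum, prod_factor,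
    ← Finset.mul_sum, ← Finset.sum_div, ← hQ.eval_eq, smul_eq_mul, ← Complex.ofReal_mul]
  congr 1
  ring

theorem IsSpecifiedBy.norm_sq_tensorPower_mulVec_monomialState (hQ : IsSpecifiedBy Q h)
    (hhom : Q.IsHomogeneous d) (hd : 0 < d) (hk : 0 < k) (r : Fin n → Fin (k + 1)) :
    ‖(tensorPower n (squashedQFT k) *ᵥ monomialState k h) r‖ ^ 2 =
      squashedProb k Q (fun i => (k : ℤ) - 2 * (r i : ℕ)) := by
  have prod_sq : (∏ i, √(k.choose (r i) / 2 ^ k)) ^ 2 =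
      (∏ i, (k.choose (r i) : ℝ)) / 2 ^ (k * n) := by
    rw [← Finset.prod_pow, Finset.prod_congr rfl fun i _ => Real.sq_sqrt (by positivity),
      Finset.prod_div_distrib, Finset.prod_const, Finset.card_univ, Fintype.card_fin, pow_mul]
  have sqrt_pow_sq : (√(k : ℝ) ^ d) ^ 2 = (k : ℝ) ^ d := by
    rw [← pow_mul, mul_comm, pow_mul, Real.sq_sqrt (Nat.cast_nonneg k)]
  rw [hQ.tensorPower_mulVec_monomialState hhom hk, Complex.norm_real, Real.norm_eq_abs, sq_abs,
    squashedProb, hQ.polynomialVariance_eq hhom hd hk, div_pow, mul_pow, mul_pow, prod_sq,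
    sqrt_pow_sq, Real.sq_sqrt (Nat.cast_nonneg m)]
  simp only [orbitSize_sub_two_mul (Fin.is_le _)]
  push_cast
  ring

end Amplitudes

/-! ### Quantum circuits on part of the qubits -/

section Lift

variable {ι ι' κ : Type*} [Fintype ι] [DecidableEq ι] [Fintype ι'] [DecidableEq ι']
  [Fintype κ]

theorem mulVec_ket (A : Matrix (ι → Bool) (ι → Bool) ℂ) (y : ι → Bool) : A *ᵥ ket y = A.col y :=
  Matrix.mulVec_single_one A y

theorem ext_of_mulVec_ket {A B : Matrix (ι → Bool) (ι → Bool) ℂ}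
    (h : ∀ y, A *ᵥ ket y = B *ᵥ ket y) : A = B := by
  ext x y
  simpa only [mulVec_ket, Matrix.col_apply] using congrFun (h y) x

theorem sum_ket_smul {M : Type*} [AddCommMonoid M] [Module ℂ M] (v : ι → Bool)
    (w : (ι → Bool) → M) : ∑ u, ket v u • w u = w v := by
  simp [ket, Pi.single_apply]

theorem Implements.mulVec_sum {E : κ → ι → Bool} {V : Matrix κ κ ℂ}
    {A : Matrix (ι → Bool) (ι → Bool) ℂ} (hA : Implements E V A) (c : κ → ℂ) :
    A *ᵥ ∑ j, c j • ket (E j) = ∑ i, (V *ᵥ c) i • ket (E i) := by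
  simp only [Matrix.mulVec_sum, Matrix.mulVec_smul, hA _, Matrix.mulVec, dotProduct,
    Finset.smul_sum, Finset.sum_smul, smul_smul]
  rw [Finset.sum_comm]
  simp only [mul_comm]

theorem Implements.mul {E : κ → ι → Bool} {V W : Matrix κ κ ℂ}
    {A B : Matrix (ι → Bool) (ι → Bool) ℂ} (hA : Implements E V A) (hB : Implements E W B) :
    Implements E (V * W) (A * B) := fun j => by
  rw [← Matrix.mulVec_mulVec, hB j, hA.mulVec_sum]
  rfl

theorem implements_one [DecidableEq κ] (E : κ → ι → Bool) : Implements E 1 1 := fun j => by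
  simp [Matrix.one_apply]

theorem Implements.comp {E : (ι' → Bool) → ι → Bool} {F : κ → ι' → Bool} {U : Matrix κ κ ℂ}
    {V : Matrix (ι' → Bool) (ι' → Bool) ℂ} {A : Matrix (ι → Bool) (ι → Bool) ℂ}
    (hA : Implements E V A) (hV : Implements F U V) : Implements (E ∘ F) U A := fun j => by
  have column (i : ι' → Bool) : V i (F j) = ∑ l, U l j * ket (F l) i := by
    simpa [mulVec_ket, Finset.sum_apply] using congrFun (hV j) i
  rw [Function.comp_apply, hA]
  simp only [column, Finset.sum_smul]
  rw [Finset.sum_comm]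
  simp [ket, Pi.single_apply]

open Classical in
/-- The operator that acts as `A` on the qubits in the range of `g` and trivially on the others. -/
noncomputable def liftOperator {ι ι' : Type*} (g : ι' ↪ ι)
    (A : Matrix (ι' → Bool) (ι' → Bool) ℂ) : Matrix (ι → Bool) (ι → Bool) ℂ :=
  Matrix.of fun x y => if ∀ q, q ∉ Set.range g → x q = y q then A (x ∘ g) (y ∘ g) else 0

theorem eq_extend_iff {α β γ : Type*} (g : α ↪ β) {u : α → γ} {x y : β → γ} :
    x = Function.extend g u y ↔ (∀ q, q ∉ Set.range g → x q = y q) ∧ x ∘ g = u := by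
  constructor
  · rintro rfl
    exact ⟨fun q hq => Function.extend_apply' _ _ _ hq, Function.extend_comp g.injective _ _⟩
  · rintro ⟨agree, rfl⟩
    funext q
    by_cases hq : q ∈ Set.range g
    · obtain ⟨q, rfl⟩ := hq
      rw [g.injective.extend_apply, Function.comp_apply]
    · rw [Function.extend_apply' _ _ _ hq, agree q hq]

theorem extend_comp_eq_self {α β γ : Type*} (g : α ↪ β) (y : β → γ) :
    Function.extend g (y ∘ g) y = y :=
  ((eq_extend_iff g).2 ⟨fun _ _ => rfl, rfl⟩).symm

theorem implements_liftOperator (g : ι' ↪ ι) (A : Matrix (ι' → Bool) (ι' → Bool) ℂ)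
    (y : ι → Bool) : Implements (fun u => Function.extend g u y) A (liftOperator g A) := by
  intro u
  funext x
  have agree_iff : (∀ q, q ∉ Set.range g → x q = Function.extend g u y q) ↔
      ∀ q, q ∉ Set.range g → x q = y q :=
    forall₂_congr fun q hq => by rw [Function.extend_apply' _ _ _ hq]
  rw [mulVec_ket]
  simp only [Matrix.col_apply, liftOperator, Matrix.of_apply, agree_iff,
    Function.extend_comp g.injective, Finset.sum_apply, Pi.smul_apply, ket, Pi.single_apply,
    eq_extend_iff, smul_eq_mul, mul_ite, mul_one, mul_zero, ite_and]
  split_ifs <;> simp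

theorem liftOperator_mulVec_ket (g : ι' ↪ ι) (A : Matrix (ι' → Bool) (ι' → Bool) ℂ)
    (y : ι → Bool) :
    liftOperator g A *ᵥ ket y = ∑ u, (A *ᵥ ket (y ∘ g)) u • ket (Function.extend g u y) := by
  simpa only [extend_comp_eq_self, mulVec_ket, Matrix.col_apply] using
    implements_liftOperator g A y (y ∘ g)

theorem eq_liftOperator {g : ι' ↪ ι} {V : Matrix (ι' → Bool) (ι' → Bool) ℂ}
    {A : Matrix (ι → Bool) (ι → Bool) ℂ}
    (hA : ∀ y, Implements (fun u => Function.extend g u y) V A) : A = liftOperator g V :=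
  ext_of_mulVec_ket fun y => by
    rw [liftOperator_mulVec_ket]
    simpa only [extend_comp_eq_self, mulVec_ket, Matrix.col_apply] using hA y (y ∘ g)

theorem liftOperator_mul (g : ι' ↪ ι) (A B : Matrix (ι' → Bool) (ι' → Bool) ℂ) :
    liftOperator g (A * B) = liftOperator g A * liftOperator g B :=
  (eq_liftOperator fun y =>
    (implements_liftOperator g A y).mul (implements_liftOperator g B y)).symm

theorem liftOperator_one {ι ι' : Type*} [DecidableEq (ι → Bool)] [DecidableEq (ι' → Bool)]
    (g : ι' ↪ ι) : liftOperator g (1 : Matrix (ι' → Bool) (ι' → Bool) ℂ) = 1 := by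
  ext x y
  have eq_iff := eq_extend_iff g (u := y ∘ g) (x := x) (y := y)
  rw [extend_comp_eq_self] at eq_iff
  simp only [liftOperator, Matrix.of_apply, Matrix.one_apply, eq_iff]
  split_ifs <;> tauto

theorem liftOperator_liftOperator {ι ι' ι'' : Type*} (g : ι' ↪ ι) (e : ι'' ↪ ι')
    (A : Matrix (ι'' → Bool) (ι'' → Bool) ℂ) :
    liftOperator g (liftOperator e A) = liftOperator (e.trans g) A := by
  classical
  ext x y
  have agree_iff : (∀ q, q ∉ Set.range (e.trans g) → x q = y q) ↔
      (∀ q, q ∉ Set.range g → x q = y q) ∧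
        ∀ q, q ∉ Set.range e → (x ∘ g) q = (y ∘ g) q := by
    refine ⟨fun h => ⟨fun q hq => h q ?_, fun q hq => h (g q) ?_⟩, fun ⟨hg, he⟩ q hq => ?_⟩
    · rintro ⟨i, rfl⟩
      exact hq ⟨e i, rfl⟩
    · rintro ⟨i, hi⟩
      exact hq ⟨i, g.injective hi⟩
    · by_cases hqg : q ∈ Set.range g
      · obtain ⟨q, rfl⟩ := hqg
        exact he q fun ⟨i, hi⟩ => hq ⟨i, congrArg g hi⟩
      · exact hg q hqg
  simp only [liftOperator, Matrix.of_apply]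
  rw [if_congr agree_iff rfl rfl, ite_and]
  rfl

theorem liftOperator_conjTranspose {ι ι' : Type*} (g : ι' ↪ ι)
    (A : Matrix (ι' → Bool) (ι' → Bool) ℂ) : liftOperator g Aᴴ = (liftOperator g A)ᴴ := by
  ext x y
  simp only [liftOperator, Matrix.of_apply, Matrix.conjTranspose_apply, apply_ite star, star_zero]
  congr! 3
  exact eq_comm

theorem liftOperator_mem_unitaryGroup (g : ι' ↪ ι) {A : Matrix (ι' → Bool) (ι' → Bool) ℂ}
    (hA : A ∈ Matrix.unitaryGroup (ι' → Bool) ℂ) :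
    liftOperator g A ∈ Matrix.unitaryGroup (ι → Bool) ℂ := by
  rw [Matrix.mem_unitaryGroup_iff, Matrix.star_eq_conjTranspose] at hA ⊢
  rw [← liftOperator_conjTranspose, ← liftOperator_mul, hA, liftOperator_one]

theorem isLocalUnitary_iff {b : ℕ} {A : Matrix (ι → Bool) (ι → Bool) ℂ} :
    IsLocalUnitary b A ↔ ∃ c ≤ b, ∃ e : Fin c ↪ ι,
      ∃ U ∈ Matrix.unitaryGroup (Fin c → Bool) ℂ, A = liftOperator e U := by
  simp only [IsLocalUnitary, liftOperator]
  congr!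

theorem IsLocalUnitary.mono {b b' : ℕ} (hb : b ≤ b') {A : Matrix (ι → Bool) (ι → Bool) ℂ}
    (hA : IsLocalUnitary b A) : IsLocalUnitary b' A := by
  obtain ⟨c, hc, hA⟩ := hA
  exact ⟨c, hc.trans hb, hA⟩

theorem IsLocalUnitary.lift {b : ℕ} (g : ι' ↪ ι) {A : Matrix (ι' → Bool) (ι' → Bool) ℂ}
    (hA : IsLocalUnitary b A) : IsLocalUnitary b (liftOperator g A) := by
  obtain ⟨c, hc, e, U, hU, rfl⟩ := isLocalUnitary_iff.1 hA
  exact isLocalUnitary_iff.2 ⟨c, hc, e.trans g, U, hU, liftOperator_liftOperator g e U⟩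

theorem IsLocalUnitary.conjTranspose {b : ℕ} {A : Matrix (ι → Bool) (ι → Bool) ℂ}
    (hA : IsLocalUnitary b A) : IsLocalUnitary b Aᴴ := by
  obtain ⟨c, hc, e, U, hU, rfl⟩ := isLocalUnitary_iff.1 hA
  exact isLocalUnitary_iff.2
    ⟨c, hc, e, Uᴴ, Unitary.star_mem hU, (liftOperator_conjTranspose e U).symm⟩

theorem IsLocalUnitary.mem_unitaryGroup {b : ℕ} {A : Matrix (ι → Bool) (ι → Bool) ℂ}
    (hA : IsLocalUnitary b A) : A ∈ Matrix.unitaryGroup (ι → Bool) ℂ := by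
  obtain ⟨c, -, e, U, hU, rfl⟩ := isLocalUnitary_iff.1 hA
  exact liftOperator_mem_unitaryGroup e hU

theorem isLocalUnitary_liftOperator {b : ℕ} (g : ι' ↪ ι) {A : Matrix (ι' → Bool) (ι' → Bool) ℂ}
    (hA : A ∈ Matrix.unitaryGroup (ι' → Bool) ℂ) (hb : Fintype.card ι' ≤ b) :
    IsLocalUnitary b (liftOperator g A) := by
  let σ := Fintype.equivFin ι'
  let τ : (Fin (Fintype.card ι') → Bool) ≃ (ι' → Bool) := σ.symm.arrowCongr (Equiv.refl Bool)
  have comp_symm (x : ι' → Bool) : τ (x ∘ σ.symm) = x := by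
    funext q
    simp [τ, Equiv.arrowCongr]
  have lift_eq : A = liftOperator σ.symm.toEmbedding (A.submatrix τ τ) := by
    ext x y
    simp [liftOperator, comp_symm]
  refine IsLocalUnitary.lift g (isLocalUnitary_iff.2 ⟨_, hb, _, _, ?_, lift_eq⟩)
  rw [Matrix.mem_unitaryGroup_iff, Matrix.star_eq_conjTranspose] at hA ⊢
  rw [Matrix.conjTranspose_submatrix, Matrix.submatrix_mul_equiv, hA, Matrix.submatrix_one_equiv]

namespace HasLocalDecomposition

variable {b b' s s' : ℕ} {A B : Matrix (ι → Bool) (ι → Bool) ℂ}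

theorem mono (hA : HasLocalDecomposition b s A) (hb : b ≤ b') (hs : s ≤ s') :
    HasLocalDecomposition b' s' A := by
  obtain ⟨l, length_le, isLocal, rfl⟩ := hA
  exact ⟨l, length_le.trans hs, fun B hB => (isLocal B hB).mono hb, rfl⟩

theorem one (b : ℕ) : HasLocalDecomposition b 0 (1 : Matrix (ι → Bool) (ι → Bool) ℂ) :=
  ⟨[], by simp, by simp, by simp⟩

theorem mul (hA : HasLocalDecomposition b s A) (hB : HasLocalDecomposition b s' B) :
    HasLocalDecomposition b (s + s') (A * B) := by
  obtain ⟨l, length_le, isLocal, rfl⟩ := hA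
  obtain ⟨l', length_le', isLocal', rfl⟩ := hB
  refine ⟨l ++ l', by simpa using Nat.add_le_add length_le length_le', fun C hC => ?_, by simp⟩
  exact (List.mem_append.1 hC).elim (isLocal C) (isLocal' C)

theorem conjTranspose (hA : HasLocalDecomposition b s A) : HasLocalDecomposition b s Aᴴ := by
  obtain ⟨l, length_le, isLocal, rfl⟩ := hA
  refine ⟨(l.map Matrix.conjTranspose).reverse, by simpa using length_le, fun B hB => ?_,
    (Matrix.conjTranspose_list_prod l).symm⟩
  obtain ⟨C, hC, rfl⟩ := List.mem_map.1 (List.mem_reverse.1 hB)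
  exact (isLocal C hC).conjTranspose

theorem lift (g : ι' ↪ ι) {A : Matrix (ι' → Bool) (ι' → Bool) ℂ}
    (hA : HasLocalDecomposition b s A) : HasLocalDecomposition b s (liftOperator g A) := by
  obtain ⟨l, length_le, isLocal, rfl⟩ := hA
  refine ⟨l.map (liftOperator g), by simpa using length_le, fun B hB => ?_, ?_⟩
  · obtain ⟨C, hC, rfl⟩ := List.mem_map.1 hB
    exact (isLocal C hC).lift g
  · clear length_le isLocal
    induction l with
    | nil => simp [liftOperator_one]
    | cons A l ih => simp [ih, liftOperator_mul]

theorem mem_unitaryGroup (hA : HasLocalDecomposition b s A) :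
    A ∈ Matrix.unitaryGroup (ι → Bool) ℂ := by
  obtain ⟨l, -, isLocal, rfl⟩ := hA
  exact list_prod_mem fun B hB => (isLocal B hB).mem_unitaryGroup

end HasLocalDecomposition

theorem IsLocalUnitary.hasLocalDecomposition {b : ℕ} {A : Matrix (ι → Bool) (ι → Bool) ℂ}
    (hA : IsLocalUnitary b A) : HasLocalDecomposition b 1 A :=
  ⟨[A], by simp, by simpa using hA, by simp⟩

end Lift

/-! ### The tensor power of the transform -/

section Tensor

variable {κ : Type*} {n : ℕ}

/-- The tensor product of matrices `V i`, acting on `n` qudits; it interpolates between the identity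
and the tensor power. -/
def tensorProduct (V : Fin n → Matrix κ κ ℂ) : Matrix (Fin n → κ) (Fin n → κ) ℂ :=
  Matrix.of fun r s => ∏ i, V i (r i) (s i)

theorem tensorProduct_mul [Fintype κ] (V W : Fin n → Matrix κ κ ℂ) :
    tensorProduct V * tensorProduct W = tensorProduct fun i => V i * W i := by
  ext r s
  simp only [tensorProduct, Matrix.mul_apply, Matrix.of_apply, ← Finset.prod_mul_distrib]
  rw [Finset.prod_univ_sum, Fintype.piFinset_univ]

theorem tensorProduct_one [DecidableEq κ] :
    tensorProduct (fun _ : Fin n => (1 : Matrix κ κ ℂ)) = 1 := by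
  ext r s
  simp only [tensorProduct, Matrix.of_apply, Matrix.one_apply, Finset.prod_ite_zero,
    Finset.prod_const_one, funext_iff, Finset.mem_univ, true_imp_iff]

theorem tensorProduct_update_one_apply [DecidableEq κ] (i : Fin n) (V : Matrix κ κ ℂ)
    (r s : Fin n → κ) :
    tensorProduct (Function.update (fun _ => 1) i V) r s =
      if Function.update s i (r i) = r then V (r i) (s i) else 0 := by
  simp only [tensorProduct, Matrix.of_apply]
  rw [← Finset.mul_prod_erase _ _ (Finset.mem_univ i), Function.update_self,
    Finset.prod_congr rfl fun j hj => by rw [Function.update_of_ne (Finset.ne_of_mem_erase hj)]]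
  simp only [Matrix.one_apply, Finset.prod_ite_zero, Finset.prod_const_one]
  rw [mul_ite, mul_one, mul_zero]
  refine if_congr ?_ rfl rfl
  rw [Function.update_eq_iff]
  simp [eq_comm]

variable {ι ι' : Type*} [Fintype ι] [DecidableEq ι] [Fintype ι'] [DecidableEq ι']
  [Fintype κ] {E : (Fin n → κ) → ι → Bool} {e : κ → ι' → Bool}
  {g : Fin n → ι' ↪ ι} {V : Matrix κ κ ℂ} {A : Matrix (ι' → Bool) (ι' → Bool) ℂ}

theorem Implements.tensorProduct_update_one [DecidableEq κ]
    (hE : ∀ i r j, Function.extend (g i) (e j) (E r) = E (Function.update r i j))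
    (hA : Implements e V A) (i : Fin n) :
    Implements E (tensorProduct (Function.update (fun _ => 1) i V)) (liftOperator (g i) A) := by
  intro r
  have column := (implements_liftOperator (g i) A (E r)).comp hA (r i)
  simp only [Function.comp_apply, hE, Function.update_eq_self] at column
  rw [column]
  simp only [tensorProduct_update_one_apply, ite_smul, zero_smul]
  rw [← Finset.sum_filter]
  refine Finset.sum_bij (fun j _ => Function.update r i j) ?_ ?_ ?_ ?_
  · simp
  · exact fun j _ j' _ hj => Function.update_injective r i hj
  · exact fun s hs => ⟨s i, Finset.mem_univ _, (Finset.mem_filter.1 hs).2⟩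
  · simp

theorem Implements.exists_tensorPower {b s : ℕ}
    (hE : ∀ i r j, Function.extend (g i) (e j) (E r) = E (Function.update r i j))
    (hA : Implements e V A) (hs : HasLocalDecomposition b s A) :
    ∃ W, HasLocalDecomposition b (n * s) W ∧ Implements E (tensorPower n V) W := by
  classical
  have partial_product (S : Finset (Fin n)) : ∃ W, HasLocalDecomposition b (S.card * s) W ∧
      Implements E (tensorProduct fun i => if i ∈ S then V else 1) W := by
    induction S using Finset.induction_on with
    | empty =>
      refine ⟨1, by simpa using HasLocalDecomposition.one b, ?_⟩
      simpa [tensorProduct_one] using implements_one E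
    | insert i S hi ih =>
      obtain ⟨W, decomposition, implements⟩ := ih
      refine ⟨liftOperator (g i) A * W, ?_, ?_⟩
      · rw [Finset.card_insert_of_notMem hi, add_mul, one_mul, add_comm]
        exact (hs.lift _).mul decomposition
      · convert (hA.tensorProduct_update_one hE i).mul implements
        rw [tensorProduct_mul]
        congr 1
        funext j
        by_cases hj : j = i
        · subst hj
          simp [hi]
        · simp [hj]
  simpa [tensorProduct, tensorPower] using partial_product Finset.univ

end Tensor

section Registers

variable {n k a₀ a : ℕ}

/-- The qubits of the `i`-th register and the first `a₀` ancilla qubits. -/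
def registerEmbedding (n k : ℕ) (ha : a₀ ≤ a) (i : Fin n) :
    Fin k.size ⊕ Fin a₀ ↪ (Fin n × Fin k.size) ⊕ Fin a where
  toFun := Sum.map (fun q => (i, q)) (Fin.castLE ha)
  inj' := Sum.map_injective.2 ⟨fun _ _ h => (Prod.ext_iff.1 h).2, Fin.castLE_injective ha⟩

theorem extend_registerEmbedding (ha : a₀ ≤ a) (i : Fin n) (r : Fin n → Fin (k + 1))
    (j : Fin (k + 1)) :
    Function.extend (registerEmbedding n k ha i) (encodeQudit k a₀ j) (encodeQudits n k a r) =
      encodeQudits n k a (Function.update r i j) := by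
  refine ((eq_extend_iff _).2 ⟨?_, ?_⟩).symm
  · rintro (⟨i', q⟩ | _) hq
    · have : i' ≠ i := by
        rintro rfl
        exact hq ⟨Sum.inl q, rfl⟩
      simp [encodeQudits, Function.update_of_ne this]
    · rfl
  · funext q
    rcases q with _ | _ <;> simp [registerEmbedding, encodeQudits, encodeQudit]

end Registers

/-! ### Reversible evaluation of Boolean circuits -/

section Reversible

theorem permMatrix_mem_unitaryGroup {κ : Type*} [Fintype κ] [DecidableEq κ] (σ : Equiv.Perm κ) :
    σ.permMatrix ℂ ∈ Matrix.unitaryGroup κ ℂ := by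
  rw [Matrix.mem_unitaryGroup_iff, Matrix.star_eq_conjTranspose, Matrix.conjTranspose_permMatrix,
    ← Matrix.permMatrix_mul, inv_mul_cancel, Matrix.permMatrix_one]

variable {ι : Type*} [Fintype ι] [DecidableEq ι]

theorem permMatrix_mulVec_ket (σ : Equiv.Perm (ι → Bool)) (x : ι → Bool) :
    σ.permMatrix ℂ *ᵥ ket x = ket (σ.symm x) := by
  funext y
  simp only [Matrix.permMatrix_mulVec, ket, Function.comp_apply, Pi.single_apply,
    Equiv.eq_symm_apply]

theorem exists_isLocalUnitary_update {S : Finset ι} {t : ι} {f : (ι → Bool) → Bool} (ht : t ∉ S)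
    (hf : DependsOn f S) :
    ∃ A, IsLocalUnitary (S.card + 1) A ∧
      ∀ x, x t = false → A *ᵥ ket x = ket (Function.update x t (f x)) := by
  obtain ⟨F, rfl⟩ := dependsOn_iff_exists_comp.1 hf
  let g : Option S ↪ ι := (Function.Embedding.subtype (· ∈ S)).optionElim t (by simpa using ht)
  have involutive : Function.Involutive
      fun u : Option S → Bool => Function.update u none (u none ^^ F (u ∘ some)) := fun u => by
    have : Function.update u none (u none ^^ F (u ∘ some)) ∘ some = u ∘ some :=
      funext fun q => by simp
    simp [this]
  refine ⟨liftOperator g (involutive.toPerm.permMatrix ℂ),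
    isLocalUnitary_liftOperator g (permMatrix_mem_unitaryGroup _) (by simp), fun x hx => ?_⟩
  have restrict : (x ∘ g) ∘ some = (S : Set ι).domRestrict x := rfl
  have extend_update (v : Bool) :
      Function.extend g (Function.update (x ∘ g) none v) x = Function.update x t v := by
    refine ((eq_extend_iff g).2 ⟨fun q hq => ?_, ?_⟩).symm
    · exact Function.update_of_ne (fun h => hq ⟨none, h.symm⟩) _ _
    · exact Function.update_comp_eq_of_injective x g.injective none v
  rw [liftOperator_mulVec_ket, permMatrix_mulVec_ket, involutive.toPerm_symm, sum_ket_smul,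
    Function.Involutive.coe_toPerm, extend_update, restrict, Function.comp_apply,
    show g none = t from rfl, hx, Bool.false_xor, Function.comp_apply]

theorem extend_eq_update_extend_castSucc {ι β : Type*} [DecidableEq ι] {t : ℕ} (z : Fin (t + 1) ↪ ι)
    (u : Fin (t + 1) → β) (x : ι → β) :
    Function.extend z u x = Function.update
      (Function.extend (Fin.castSuccEmb.trans z) (Fin.init u) x)
      (z (Fin.last t)) (u (Fin.last t)) := by
  refine ((eq_extend_iff z).2 ⟨fun q hq => ?_, funext fun i => ?_⟩).symm
  · rw [Function.update_of_ne fun h => hq ⟨_, h.symm⟩, Function.extend_apply']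
    exact fun ⟨i, hi⟩ => hq ⟨_, hi⟩
  · induction i using Fin.lastCases with
    | last => simp
    | cast i =>
      rw [Function.comp_apply, Function.update_of_ne (z.injective.ne (Fin.castSucc_ne_last i))]
      exact (Fin.castSuccEmb.trans z).injective.extend_apply _ _ i

theorem exists_hasLocalDecomposition_extend {b c : ℕ} (out : Fin b ↪ ι)
    {S : Fin b → Finset ι} {f : Fin b → (ι → Bool) → Bool} (hf : ∀ j, DependsOn (f j) (S j))
    (hS : ∀ j, (S j).card ≤ c) (hout : ∀ i j, out i ∉ S j) :
    ∃ A, HasLocalDecomposition (c + 1) b A ∧ ∀ x, (∀ j, x (out j) = false) →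
      A *ᵥ ket x = ket (Function.extend out (fun j => f j x) x) := by
  induction b with
  | zero =>
    refine ⟨1, HasLocalDecomposition.one _, fun x _ => ?_⟩
    rw [Matrix.one_mulVec, (funext fun q => Function.extend_apply' _ _ q (by simp) :
      Function.extend out _ x = x)]
  | succ b ih =>
    obtain ⟨A, decomposition, hA⟩ := ih (Fin.castSuccEmb.trans out)
      (fun j => hf j.castSucc) (fun j => hS j.castSucc) fun i j => hout i.castSucc j.castSucc
    obtain ⟨B, isLocal, hB⟩ :=
      exists_isLocalUnitary_update (hout (Fin.last b) (Fin.last b)) (hf (Fin.last b))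
    refine ⟨B * A, ?_, fun x hx => ?_⟩
    · rw [add_comm b]
      exact (isLocal.mono (Nat.succ_le_succ (hS _))).hasLocalDecomposition.mul decomposition
    · rw [← Matrix.mulVec_mulVec, hA x fun j => hx j.castSucc, hB,
        extend_eq_update_extend_castSucc out]
      · congr 2
        refine hf _ fun q hq => Function.extend_apply' _ _ _ ?_
        rintro ⟨j, rfl⟩
        exact hout _ _ hq
      · rw [Function.extend_apply', hx]
        exact fun ⟨j, hj⟩ => (Fin.castSucc_ne_last j) (out.injective hj)

/-- One step of the evaluation of a Boolean circuit. -/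
def appendGate (wires : List Bool) (g : ℕ × ℕ) : List Bool :=
  wires ++ [!(wires.getD g.1 false && wires.getD g.2 false)]

theorem card_toFinset_getElem?_le {ι : Type*} (L : List ι) (i : ℕ) : L[i]?.toFinset.card ≤ 1 := by
  cases L[i]? <;> simp

theorem dependsOn_getD_map {ι : Type*} (L : List ι) (i : ℕ) :
    DependsOn (fun x : ι → Bool => (L.map x).getD i false) (L[i]?.toFinset : Set ι) := by
  intro x y h
  simp only [List.getD_eq_getElem?_getD, List.getElem?_map]
  cases hi : L[i]? with
  | none => rfl
  | some q => simpa using h q (by simp [hi])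

theorem exists_isLocalUnitary_appendGate (L : List ι) (g : ℕ × ℕ) {t : ι} (ht : t ∉ L) :
    ∃ A, IsLocalUnitary 3 A ∧ ∀ x, x t = false → ∃ y, A *ᵥ ket x = ket y ∧
      (∀ q, q ≠ t → y q = x q) ∧ (L ++ [t]).map y = appendGate (L.map x) g := by
  let f (x : ι → Bool) : Bool := !((L.map x).getD g.1 false && (L.map x).getD g.2 false)
  let S : Finset ι := L[g.1]?.toFinset ∪ L[g.2]?.toFinset
  have hS : S.card ≤ 2 := (Finset.card_union_le _ _).trans
    (Nat.add_le_add (card_toFinset_getElem?_le _ _) (card_toFinset_getElem?_le _ _))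
  have htS : t ∉ S := by
    simp only [S, Finset.mem_union, Option.mem_toFinset, Option.mem_def]
    rintro (h | h) <;> exact ht (List.mem_of_getElem? h)
  have hf : DependsOn f S := fun x y h => by
    have h₁ := dependsOn_getD_map L g.1 fun q hq => h q (Finset.mem_union_left _ hq)
    have h₂ := dependsOn_getD_map L g.2 fun q hq => h q (Finset.mem_union_right _ hq)
    simp only [f, h₁, h₂]
  obtain ⟨A, isLocal, hA⟩ := exists_isLocalUnitary_update htS hf
  refine ⟨A, isLocal.mono (Nat.succ_le_succ hS), fun x hx =>
    ⟨_, hA x hx, fun q hq => Function.update_of_ne hq _ _, ?_⟩⟩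
  have map_update : L.map (Function.update x t (f x)) = L.map x :=
    List.map_congr_left fun q hq => Function.update_of_ne (ne_of_mem_of_not_mem hq ht) _ _
  rw [List.map_append, map_update, List.map_singleton, Function.update_self]
  rfl

theorem exists_hasLocalDecomposition_gates (gates : List (ℕ × ℕ)) (L work : List ι)
    (hlen : work.length = gates.length) (hwork : work.Nodup) (hL : L.Disjoint work) :
    ∃ K, HasLocalDecomposition 3 gates.length K ∧ ∀ x, (∀ q ∈ work, x q = false) →
      ∃ y, K *ᵥ ket x = ket y ∧ (∀ q, q ∉ work → y q = x q) ∧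
        (L ++ work).map y = gates.foldl appendGate (L.map x) := by
  induction gates generalizing L work with
  | nil =>
    obtain rfl := List.eq_nil_of_length_eq_zero hlen
    exact ⟨1, HasLocalDecomposition.one 3, fun x _ => ⟨x, by simp⟩⟩
  | cons g gates ih =>
    obtain ⟨t, work, rfl⟩ := List.exists_cons_of_length_eq_add_one hlen
    have htL : t ∉ L := fun h => hL h List.mem_cons_self
    obtain ⟨htwork, hwork⟩ := List.nodup_cons.1 hwork
    have hL' : (L ++ [t]).Disjoint work := List.disjoint_append_left.2
      ⟨List.disjoint_of_disjoint_cons_right hL, List.singleton_disjoint.2 htwork⟩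
    obtain ⟨A, isLocal, hA⟩ := exists_isLocalUnitary_appendGate L g htL
    obtain ⟨K, decomposition, hK⟩ := ih (L ++ [t]) work (by simpa using hlen) hwork hL'
    refine ⟨K * A, decomposition.mul isLocal.hasLocalDecomposition, fun x hx => ?_⟩
    obtain ⟨y, hAy, hyx, hy⟩ := hA x (hx t List.mem_cons_self)
    obtain ⟨y', hKy', hy'y, hy'⟩ := hK y fun q hq => by
      rw [hyx q (ne_of_mem_of_not_mem hq htwork), hx q (List.mem_cons_of_mem t hq)]
    refine ⟨y', by rw [← Matrix.mulVec_mulVec, hAy, hKy'], fun q hq => ?_, ?_⟩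
    · rw [List.mem_cons, not_or] at hq
      rw [hy'y q hq.2, hyx q hq.1]
    · rw [List.foldl_cons, ← hy, ← hy', List.append_assoc, List.singleton_append]

theorem conjTranspose_mulVec_eq_of_mulVec_eq {κ : Type*} [Fintype κ] [DecidableEq κ]
    {A : Matrix κ κ ℂ} (hA : A ∈ Matrix.unitaryGroup κ ℂ) {v w : κ → ℂ} (h : A *ᵥ v = w) :
    Aᴴ *ᵥ w = v := by
  rw [← h, Matrix.mulVec_mulVec, ← Matrix.star_eq_conjTranspose, hA.1, Matrix.one_mulVec]

theorem BoolCircuit.exists_hasLocalDecomposition_of_list {a b : ℕ} (C : BoolCircuit a b)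
    {L work : List ι} (hlen : work.length = C.size) (hwork : work.Nodup) (hL : L.Disjoint work)
    (out : Fin b ↪ ι) (hout : ∀ j, out j ∉ L ++ work) :
    ∃ A, HasLocalDecomposition 3 (2 * C.size + b) A ∧
      ∀ x, (∀ q ∈ work, x q = false) → (∀ j, x (out j) = false) →
        A *ᵥ ket x = ket (Function.extend out
          (fun j => (C.gates.foldl appendGate (L.map x)).getD (C.output j) false) x) := by
  obtain ⟨K, hK, compute⟩ := exists_hasLocalDecomposition_gates C.gates L work hlen hwork hL
  obtain ⟨B, hB, copy⟩ := exists_hasLocalDecomposition_extend (c := 2) out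
    (fun j => dependsOn_getD_map (L ++ work) (C.output j))
    (fun j => (card_toFinset_getElem?_le _ _).trans one_le_two) fun i j hi =>
      hout i (List.mem_of_getElem? (Option.mem_toFinset.1 hi))
  refine ⟨Kᴴ * (B * K), (hK.conjTranspose.mul (hB.mul hK)).mono le_rfl
    (by rw [BoolCircuit.size]; omega), fun x x_work x_out => ?_⟩
  set v : Fin b → Bool := fun j => (C.gates.foldl appendGate (L.map x)).getD (C.output j) false
  have extend_eq (y : ι → Bool) {q : ι} (hq : q ∈ L ++ work) : Function.extend out v y q = y q :=
    Function.extend_apply' _ _ q fun ⟨j, hj⟩ => hout j (hj ▸ hq)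
  obtain ⟨y, hKx, hyx, hy⟩ := compute x x_work
  obtain ⟨y', hKx', hyx', hy'⟩ := compute (Function.extend out v x) fun q hq => by
    rw [extend_eq x (List.mem_append_right _ hq), x_work q hq]
  have copied : B *ᵥ ket y = ket (Function.extend out v y) := by
    rw [copy y fun j => (hyx _ fun h => hout j (List.mem_append_right _ h)).trans (x_out j), hy]
  have same_values : (L ++ work).map y' = (L ++ work).map y := by
    rw [hy', hy, List.map_congr_left fun q hq => extend_eq x (List.mem_append_left _ hq)]
  have y'_eq : y' = Function.extend out v y := by
    refine (eq_extend_iff out).2 ⟨fun q hq => ?_, funext fun j => ?_⟩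
    · by_cases hqW : q ∈ work
      · exact List.map_inj_left.1 same_values q (List.mem_append_right _ hqW)
      · rw [hyx' q hqW, hyx q hqW, Function.extend_apply' _ _ q hq]
    · rw [Function.comp_apply, hyx' _ fun h => hout j (List.mem_append_right _ h),
        out.injective.extend_apply]
  rw [← Matrix.mulVec_mulVec, ← Matrix.mulVec_mulVec, hKx, copied, ← y'_eq]
  exact conjTranspose_mulVec_eq_of_mulVec_eq hK.mem_unitaryGroup hKx'

theorem BoolCircuit.exists_hasLocalDecomposition {a b s : ℕ} (C : BoolCircuit a b)
    (hs : C.size ≤ s) (inp : Fin a → ι) (work : Fin s ↪ ι) (out : Fin b ↪ ι)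
    (inp_ne_work : ∀ i j, inp i ≠ work j) (inp_ne_out : ∀ i j, inp i ≠ out j)
    (work_ne_out : ∀ i j, work i ≠ out j) :
    ∃ A, HasLocalDecomposition 3 (2 * C.size + b) A ∧
      ∀ x, (∀ j, x (work j) = false) → (∀ j, x (out j) = false) →
        A *ᵥ ket x = ket (Function.extend out (C.eval (x ∘ inp)) x) := by
  have disjoint :
      (List.ofFn inp).Disjoint (List.ofFn fun i : Fin C.size => work (i.castLE hs)) := by
    simp only [List.disjoint_left, List.mem_ofFn]
    rintro _ ⟨i, rfl⟩ ⟨j, h⟩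
    exact inp_ne_work _ _ h.symm
  obtain ⟨A, decomposition, hA⟩ := C.exists_hasLocalDecomposition_of_list (List.length_ofFn)
    (List.nodup_ofFn.2 (work.injective.comp (Fin.castLE_injective hs))) disjoint out fun j => by
      simp only [List.mem_append, List.mem_ofFn, not_or, not_exists]
      exact ⟨fun i => inp_ne_out i j, fun i => work_ne_out _ j⟩
  refine ⟨A, decomposition, fun x x_work x_out => ?_⟩
  rw [hA x (by simpa [List.mem_ofFn] using fun i => x_work _) x_out, List.map_ofFn]
  rfl

end Reversible

/-! ### The uniform superposition of an initial segment -/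

section Superposition

theorem exists_mem_unitaryGroup_of_pairwise_orthogonal {κ 𝕜 : Type*} [RCLike 𝕜] [Fintype κ]
    [DecidableEq κ] (w : κ → EuclideanSpace 𝕜 κ)
    (hw : Pairwise fun i j => inner 𝕜 (w i) (w j) = 0) :
    ∃ U ∈ Matrix.unitaryGroup κ 𝕜, ∀ i l, (‖w i‖ : 𝕜) * U l i = w i l := by
  let u (i : κ) : EuclideanSpace 𝕜 κ := ((‖w i‖ : 𝕜)⁻¹) • w i
  have orthonormal : Orthonormal 𝕜 ({i | w i ≠ 0}.domRestrict u) := by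
    constructor
    · rintro ⟨i, hi⟩
      exact norm_smul_inv_norm hi
    · rintro ⟨i, hi⟩ ⟨j, hj⟩ hij
      simp [u, Set.domRestrict_apply, inner_smul_left, inner_smul_right,
        hw fun h => hij (Subtype.ext h)]
  obtain ⟨b, hb⟩ := orthonormal.exists_orthonormalBasis_extension_of_card_eq finrank_euclideanSpace
  refine ⟨_, OrthonormalBasis.toMatrix_orthonormalBasis_mem_unitary
    (EuclideanSpace.basisFun κ 𝕜) b, fun i l => ?_⟩
  have entry : (EuclideanSpace.basisFun κ 𝕜).toBasis.toMatrix b l i = b i l := by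
    simp [Module.Basis.toMatrix_apply]
  rw [entry]
  by_cases hi : w i = 0
  · simp [hi]
  · have norm_ne_zero : (‖w i‖ : 𝕜) ≠ 0 := by simpa using hi
    rw [hb i hi, PiLp.smul_apply, smul_eq_mul, mul_inv_cancel_left₀ norm_ne_zero]

/-- The final state of a two-state automaton with initial state `false` that reads the bits of `u`
from the lowest to the highest, with transition function `δ i` at the `i`-th bit. -/
def scan (δ : ℕ → Bool → Bool → Bool) : (t : ℕ) → (Fin t → Bool) → Bool
  | 0, _ => false
  | t + 1, u => δ t (scan δ t (Fin.init u)) (u (Fin.last t))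

theorem sum_filter_scan_succ {M : Type*} [AddCommMonoid M] (δ : ℕ → Bool → Bool → Bool) (t : ℕ)
    (f : Bool) (F : (Fin (t + 1) → Bool) → M) :
    ∑ u : Fin (t + 1) → Bool with scan δ (t + 1) u = f, F u =
      ∑ p : Bool × Bool with δ t p.1 p.2 = f, ∑ u with scan δ t u = p.1, F (Fin.snoc u p.2) := by
  simp only [Finset.sum_filter]
  rw [← (Fin.snocEquiv fun _ => Bool).sum_comp, Fintype.sum_prod_type, Fintype.sum_prod_type_right]
  refine Finset.sum_congr rfl fun b _ => ?_
  simp only [Finset.ite_sum_zero]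
  rw [Finset.sum_comm]
  refine Finset.sum_congr rfl fun u _ => ?_
  rw [Finset.sum_eq_single (scan δ t u) (fun a _ ha => by simp [ha.symm]) (by simp)]
  simp [scan, Fin.snocEquiv]

variable {ι : Type*} [Fintype ι] [DecidableEq ι]

/-- A register that consists of the two qubits `p` and `q`. -/
def pairEmbedding {ι : Type*} {p q : ι} (hpq : p ≠ q) : Bool ↪ ι where
  toFun i := bif i then q else p
  inj' := by
    rintro (_ | _) (_ | _) h
    exacts [rfl, absurd h hpq, absurd h.symm hpq, rfl]

theorem extend_pairEmbedding {ι β : Type*} [DecidableEq ι] {p q : ι} (hpq : p ≠ q)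
    (l : Bool → β) (x : ι → β) : Function.extend (pairEmbedding hpq) l x =
      Function.update (Function.update x p (l false)) q (l true) := by
  refine ((eq_extend_iff _).2 ⟨fun r hr => ?_, funext fun i => ?_⟩).symm
  · have hp : r ≠ p := fun h => hr ⟨false, h.symm⟩
    have hq : r ≠ q := fun h => hr ⟨true, h.symm⟩
    simp [hp, hq]
  · cases i
    · exact (Function.update_of_ne hpq _ _).trans (Function.update_self _ _ _)
    · exact Function.update_self _ _ _

theorem exists_isLocalUnitary_branch {p q : ι} (hpq : p ≠ q) (φ : Bool → Bool → Bool)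
    (c : Bool → ℕ) :
    ∃ U, IsLocalUnitary 2 U ∧ ∀ x, x q = false →
      (√(∑ s : Bool × Bool with φ s.1 s.2 = x p, c s.1 : ℕ) : ℂ) • U *ᵥ ket x =
        ∑ s : Bool × Bool with φ s.1 s.2 = x p,
          (√(c s.1) : ℂ) • ket (Function.update (Function.update x p s.1) q s.2) := by
  let w (i : Bool → Bool) : EuclideanSpace ℂ (Bool → Bool) := WithLp.toLp 2 fun l =>
    if i true = false ∧ φ (l false) (l true) = i false then (√(c (l false)) : ℂ) else 0
  have orthogonal : Pairwise fun i j => inner ℂ (w i) (w j) = 0 := by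
    intro i j hij
    rw [PiLp.inner_apply]
    refine Finset.sum_eq_zero fun l _ => ?_
    by_cases hi : i true = false ∧ φ (l false) (l true) = i false
    · have : ¬ (j true = false ∧ φ (l false) (l true) = j false) := fun hj =>
        hij (funext (Bool.forall_bool.2 ⟨hi.2.symm.trans hj.2, hi.1.trans hj.1.symm⟩))
      simp [w, this]
    · simp [w, hi]
  obtain ⟨U, hU, hUw : ∀ i l, (‖w i‖ : ℂ) * U l i = w i l⟩ :=
    exists_mem_unitaryGroup_of_pairwise_orthogonal w orthogonal
  let g := pairEmbedding hpq
  refine ⟨liftOperator g U, isLocalUnitary_liftOperator g hU (by simp), fun x hx => ?_⟩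
  have hp : (x ∘ g) false = x p := rfl
  have hq : (x ∘ g) true = false := hx
  have norm_eq : √(∑ s : Bool × Bool with φ s.1 s.2 = x p, c s.1 : ℕ) = ‖w (x ∘ g)‖ := by
    rw [EuclideanSpace.norm_eq, Finset.sum_filter, ← (Equiv.boolArrowEquivProd Bool).sum_comp]
    push_cast
    refine congrArg _ (Finset.sum_congr rfl fun l _ => ?_)
    simp only [w, hp, hq, true_and]
    split_ifs <;> simp_all
  rw [norm_eq, liftOperator_mulVec_ket, Finset.smul_sum, Finset.sum_filter,
    ← (Equiv.boolArrowEquivProd Bool).sum_comp]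
  refine Finset.sum_congr rfl fun l _ => ?_
  rw [smul_smul, mulVec_ket, Matrix.col_apply, hUw, extend_pairEmbedding]
  simp only [w, hp, hq, true_and, ite_smul, zero_smul]
  rfl

theorem update_extend_castSucc {ι : Type*} [DecidableEq ι] {t : ℕ} {z : Fin (t + 1) ↪ ι} {flag : ι}
    (hflag : ∀ i, z i ≠ flag) (u : Fin t → Bool) (c d : Bool) (x : ι → Bool) :
    Function.update (Function.extend (Fin.castSuccEmb.trans z) u
        (Function.update (Function.update x flag c) (z (Fin.last t)) d)) flag false =
      Function.update (Function.extend z (Fin.snoc u d) x) flag false := by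
  funext q
  rcases eq_or_ne q flag with rfl | hq
  · simp only [Function.update_self]
  rw [Function.update_of_ne hq, Function.update_of_ne hq, extend_eq_update_extend_castSucc,
    Fin.init_snoc, Fin.snoc_last]
  rcases eq_or_ne q (z (Fin.last t)) with rfl | hq'
  · rw [Function.update_self, Function.extend_apply', Function.update_self]
    exact fun ⟨i, hi⟩ => Fin.castSucc_ne_last i (z.injective hi)
  · rw [Function.update_of_ne hq', Function.extend_def, Function.extend_def,
      Function.update_of_ne hq', Function.update_of_ne hq]

theorem exists_hasLocalDecomposition_scan (δ : ℕ → Bool → Bool → Bool) {t : ℕ} (z : Fin t ↪ ι)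
    {flag : ι} (hflag : ∀ i, z i ≠ flag) :
    ∃ T, HasLocalDecomposition 2 t T ∧ ∀ x, (∀ i, x (z i) = false) →
      (√(Finset.card {u | scan δ t u = x flag}) : ℂ) • T *ᵥ ket x =
        ∑ u with scan δ t u = x flag,
          ket (Function.update (Function.extend z u x) flag false) := by
  induction t with
  | zero =>
    refine ⟨1, .one 2, fun x _ => ?_⟩
    have extend_eq (u : Fin 0 → Bool) : Function.extend z u x = x :=
      ((eq_extend_iff z).2 ⟨fun _ _ => rfl, Subsingleton.elim _ _⟩).symm
    cases hx : x flag
    · have update_eq : Function.update x flag false = x := by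
        rw [← hx, Function.update_eq_self]
      simp [scan, extend_eq, update_eq]
    · simp [scan]
  | succ t ih =>
    let z' := Fin.castSuccEmb.trans z
    let count (f : Bool) := Finset.card {u | scan δ t u = f}
    have flag_ne : flag ≠ z (Fin.last t) := (hflag _).symm
    obtain ⟨T, hT, T_ket⟩ := ih (z := z') fun i => hflag _
    obtain ⟨U, hU, U_ket⟩ := exists_isLocalUnitary_branch flag_ne (δ t) count
    refine ⟨T * U, hT.mul hU.hasLocalDecomposition, fun x hx => ?_⟩
    have card_eq : Finset.card {u | scan δ (t + 1) u = x flag} =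
        ∑ s : Bool × Bool with δ t s.1 s.2 = x flag, count s.1 := by
      simp only [count, Finset.card_eq_sum_ones]
      exact sum_filter_scan_succ δ t (x flag) fun _ => 1
    rw [card_eq, ← Matrix.mulVec_mulVec, ← Matrix.mulVec_smul, U_ket x (hx _),
      sum_filter_scan_succ, Matrix.mulVec_sum]
    refine Finset.sum_congr rfl fun s _ => ?_
    have clean (i : Fin t) : Function.update (Function.update x flag s.1) (z (Fin.last t)) s.2
        (z i.castSucc) = false := by
      rw [Function.update_of_ne (z.injective.ne (Fin.castSucc_ne_last i)),
        Function.update_of_ne (hflag _), hx]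
    rw [Matrix.mulVec_smul]
    have T_eq := T_ket _ clean
    rw [Function.update_of_ne flag_ne, Function.update_self] at T_eq
    refine T_eq.trans (Finset.sum_congr rfl fun u _ => ?_)
    rw [update_extend_castSucc hflag]

/-- The transition function of the comparison with `N`, from the lowest to the highest bit. -/
def comparator (N t : ℕ) (flag bit : Bool) : Bool := if bit = N.testBit t then flag else bit

theorem scan_comparator_binary (N t j : ℕ) :
    scan (comparator N) t (binary t j) = decide (N % 2 ^ t < j % 2 ^ t) := by
  induction t with
  | zero => simp [scan, Nat.mod_one]
  | succ t ih =>
    have init_binary : Fin.init (binary (t + 1) j) = binary t j := rfl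
    have last_binary : binary (t + 1) j (Fin.last t) = j.testBit t := rfl
    have mod_succ (a : ℕ) : a % 2 ^ (t + 1) = a % 2 ^ t + 2 ^ t * (a.testBit t).toNat := by
      rw [pow_succ, Nat.mod_mul, Nat.toNat_testBit]
    have hN := Nat.mod_lt N (Nat.two_pow_pos t)
    have hj := Nat.mod_lt j (Nat.two_pow_pos t)
    rw [scan, init_binary, last_binary, ih, mod_succ, mod_succ, comparator]
    cases N.testBit t <;> cases j.testBit t <;> simp <;> omega

theorem binary_ofBits {t : ℕ} (u : Fin t → Bool) : binary t (Nat.ofBits u) = u :=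
  funext fun i => Nat.testBit_ofBits_lt u i i.2

theorem ofBits_binary {t j : ℕ} (hj : j < 2 ^ t) : Nat.ofBits (binary t j) = j :=
  (Nat.ofBits_testBit j t).trans (Nat.mod_eq_of_lt hj)

theorem exists_hasLocalDecomposition_uniform {n m : ℕ} (hm : 0 < m) (hmn : m ≤ 2 ^ n)
    (z : Fin n ↪ ι) {flag : ι} (hflag : ∀ i, z i ≠ flag) :
    ∃ T, HasLocalDecomposition 2 n T ∧ ∀ x, (∀ i, x (z i) = false) → x flag = false →
      T *ᵥ ket x = (((√m)⁻¹ : ℝ) : ℂ) • ∑ j : Fin m, ket (Function.extend z (binary n j) x) := by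
  obtain ⟨T, hT, T_ket⟩ := exists_hasLocalDecomposition_scan (comparator (m - 1)) z hflag
  refine ⟨T, hT, fun x hx hxflag => ?_⟩
  have lt_two_pow (j : Fin m) : (j : ℕ) < 2 ^ n := j.2.trans_le hmn
  have scan_binary {j : ℕ} (hj : j < 2 ^ n) :
      scan (comparator (m - 1)) n (binary n j) = false ↔ j < m := by
    rw [scan_comparator_binary, Nat.mod_eq_of_lt hj, Nat.mod_eq_of_lt (by omega),
      decide_eq_false_iff_not]
    omega
  let digits : Fin m ↪ (Fin n → Bool) :=
    ⟨fun j => binary n j, fun i j hij => by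
      simpa only [ofBits_binary (lt_two_pow _), Fin.val_inj] using congrArg Nat.ofBits hij⟩
  have accepted_eq : ({u | scan (comparator (m - 1)) n u = x flag} : Finset _) =
      Finset.univ.map digits := by
    ext u
    simp only [Finset.mem_filter_univ, Finset.mem_map, Finset.mem_univ, true_and, hxflag]
    constructor
    · intro hu
      rw [← binary_ofBits u] at hu
      exact ⟨⟨_, (scan_binary (Nat.ofBits_lt_two_pow u)).1 hu⟩, binary_ofBits u⟩
    · rintro ⟨j, rfl⟩
      exact (scan_binary (lt_two_pow j)).2 j.2
  have flag_clean (u : Fin n → Bool) : Function.update (Function.extend z u x) flag false =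
      Function.extend z u x := by
    rw [Function.update_eq_self_iff, Function.extend_apply' _ _ _ fun ⟨i, hi⟩ => hflag i hi,
      hxflag]
  have T_eq := T_ket x hx
  rw [accepted_eq, Finset.card_map, Finset.sum_map, Finset.card_fin] at T_eq
  simp only [flag_clean] at T_eq
  have sqrt_ne_zero : (√m : ℂ) ≠ 0 := by simpa using hm.ne'
  rw [Complex.ofReal_inv, eq_inv_smul_iff₀ sqrt_ne_zero]
  exact T_eq

end Superposition

/-! ### Preparing the initial state -/

section Preparation

variable {n m k s a : ℕ}

/-- A basis state of an `n`-bit register holding `u`, an `n`-bit register holding `v`, `s` work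
qubits in state `0` and a flag qubit in state `0`. -/
def workspaceState (s : ℕ) (u v : Fin n → Bool) : Fin n ⊕ (Fin n ⊕ (Fin s ⊕ Unit)) → Bool :=
  Sum.elim u (Sum.elim v fun _ => false)

theorem extend_inl_workspaceState (u u' v : Fin n → Bool) :
    Function.extend (Function.Embedding.inl : Fin n ↪ Fin n ⊕ _) u' (workspaceState s u v) =
      workspaceState s u' v := by
  refine ((eq_extend_iff .inl (x := workspaceState s u' v)).2 ⟨?_, rfl⟩).symm
  rintro (q | q) hq
  · exact absurd ⟨q, rfl⟩ hq
  · rfl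

theorem extend_inr_inl_workspaceState (u v v' : Fin n → Bool) :
    Function.extend (Function.Embedding.inl.trans Function.Embedding.inr : Fin n ↪ Fin n ⊕ _) v'
      (workspaceState s u v) = workspaceState s u v' := by
  refine ((eq_extend_iff (.trans .inl .inr) (x := workspaceState s u v')).2 ⟨?_, rfl⟩).symm
  rintro (q | q | q) hq
  · rfl
  · exact absurd ⟨q, rfl⟩ hq
  · rfl

theorem exists_hasLocalDecomposition_workspaceState {κ : Type*} {u v : κ → Fin n → Bool}
    (C C' : BoolCircuit n n) (hC : ∀ z, C.eval (v z) = u z) (hC' : ∀ z, C'.eval (u z) = v z)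
    (hs : C.size ≤ s) (hs' : C'.size ≤ s) :
    ∃ R, HasLocalDecomposition 3 (2 * n + 2 * C.size + 2 * C'.size) R ∧
      ∀ z, R *ᵥ ket (workspaceState s (fun _ => false) (v z)) =
        ket (workspaceState s (u z) fun _ => false) := by
  let left : Fin n ↪ Fin n ⊕ (Fin n ⊕ (Fin s ⊕ Unit)) := .inl
  let right : Fin n ↪ Fin n ⊕ (Fin n ⊕ (Fin s ⊕ Unit)) := .trans .inl .inr
  let work : Fin s ↪ Fin n ⊕ (Fin n ⊕ (Fin s ⊕ Unit)) := .trans (.trans .inl .inr) .inr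
  obtain ⟨A, hA, A_ket⟩ := C.exists_hasLocalDecomposition hs right work left
    (by simp [right, work]) (by simp [right, left]) (by simp [work, left])
  obtain ⟨B, hB, B_ket⟩ := C'.exists_hasLocalDecomposition hs' left work right
    (by simp [left, work]) (by simp [right, left]) (by simp [work, right])
  refine ⟨Bᴴ * A, (hB.conjTranspose.mul hA).mono le_rfl (by omega), fun z => ?_⟩
  have A_eq : A *ᵥ ket (workspaceState s (fun _ => false) (v z)) =
      ket (workspaceState s (u z) (v z)) := by
    rw [A_ket _ (fun _ => rfl) fun _ => rfl, extend_inl_workspaceState, ← hC z]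
    rfl
  have B_eq : B *ᵥ ket (workspaceState s (u z) fun _ => false) =
      ket (workspaceState s (u z) (v z)) := by
    rw [B_ket _ (fun _ => rfl) fun _ => rfl, extend_inr_inl_workspaceState, ← hC' z]
    rfl
  rw [← Matrix.mulVec_mulVec, A_eq, conjTranspose_mulVec_eq_of_mulVec_eq hB.mem_unitaryGroup B_eq]

theorem exists_hasLocalDecomposition_codewords (hm : 0 < m) {h : Fin m → Fin n → Bool}
    (hinj : Function.Injective h) (C C' : BoolCircuit n n)
    (hC : ∀ z : Fin m, C.eval (binary n z) = h z) (hC' : ∀ z : Fin m, C'.eval (h z) = binary n z)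
    (hs : C.size ≤ s) (hs' : C'.size ≤ s) :
    ∃ P, HasLocalDecomposition 3 (3 * n + 2 * C.size + 2 * C'.size) P ∧
      P *ᵥ ket (workspaceState s (fun _ => false) fun _ => false) =
        (((√m)⁻¹ : ℝ) : ℂ) • ∑ z, ket (workspaceState s (h z) fun _ => false) := by
  have hmn : m ≤ 2 ^ n := by simpa using Fintype.card_le_of_injective h hinj
  obtain ⟨R, hR, R_ket⟩ := exists_hasLocalDecomposition_workspaceState C C' hC hC' hs hs'
  obtain ⟨T, hT, T_ket⟩ := exists_hasLocalDecomposition_uniform hm hmn (.trans .inl .inr)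
    (flag := (.inr (.inr (.inr ())) : Fin n ⊕ (Fin n ⊕ (Fin s ⊕ Unit)))) (by simp)
  refine ⟨R * T, (hR.mul (hT.mono (by simp) le_rfl)).mono le_rfl (by omega), ?_⟩
  rw [← Matrix.mulVec_mulVec, T_ket _ (fun _ => rfl) rfl, Matrix.mulVec_smul, Matrix.mulVec_sum]
  simp only [extend_inr_inl_workspaceState, R_ket]

/-- The lowest qubit of each of the `n` registers of `k.size` qubits. -/
def lowQubit (n : ℕ) (hk : 0 < k) : Fin n ↪ Fin n × Fin k.size :=
  .sectL (Fin n) ⟨0, Nat.size_pos.2 hk⟩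

theorem binary_bitLevel (hk : 0 < k) {t : ℕ} (b : Bool) (q : Fin t) :
    binary t (bitLevel hk b) q = if (q : ℕ) = 0 then b else false := by
  cases b <;> simp [binary, bitLevel, ← Nat.testBit_one_eq_true_iff_self_eq_zero]

theorem extend_lowQubit (hk : 0 < k) (e : Fin n ⊕ (Fin s ⊕ Unit) ↪ Fin a) (u : Fin n → Bool) :
    Function.extend ((lowQubit n hk).sumMap e) (workspaceState s u fun _ => false)
      (fun _ => false) = encodeQudits n k a fun i => bitLevel hk (u i) := by
  refine ((eq_extend_iff _).2 ⟨?_, ?_⟩).symm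
  · rintro (⟨i, q⟩ | q) hq
    · refine (binary_bitLevel hk _ q).trans (if_neg fun hq0 => hq ⟨.inl i, ?_⟩)
      exact congrArg (fun q => Sum.inl (i, q)) (Fin.ext hq0.symm)
    · rfl
  · funext q
    rcases q with i | i | q
    · exact binary_bitLevel hk _ _
    · rfl
    · rfl

theorem sum_monomialState_smul {M : Type*} [AddCommMonoid M] [Module ℂ M] (hk : 0 < k)
    (h : Fin m → Fin n → Bool) (F : (Fin n → Fin (k + 1)) → M) :
    ∑ r, monomialState k h r • F r =
      (((√m)⁻¹ : ℝ) : ℂ) • ∑ z, F fun i => bitLevel hk (h z i) := by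
  simp only [monomialState_eq hk, Pi.smul_apply, Finset.sum_apply, smul_assoc, Finset.sum_smul]
  rw [← Finset.smul_sum, Finset.sum_comm]
  simp [Pi.single_apply]

theorem exists_hasLocalDecomposition_monomialState (hk : 0 < k) (hm : 0 < m)
    {h : Fin m → Fin n → Bool} (hinj : Function.Injective h) (C C' : BoolCircuit n n)
    (hC : ∀ z : Fin m, C.eval (binary n z) = h z) (hC' : ∀ z : Fin m, C'.eval (h z) = binary n z)
    (ha : n + max C.size C'.size < a) :
    ∃ P, HasLocalDecomposition 3 (3 * n + 2 * C.size + 2 * C'.size) P ∧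
      P *ᵥ ket (fun _ => false) = ∑ r, monomialState k h r • ket (encodeQudits n k a r) := by
  obtain ⟨P, hP, P_ket⟩ := exists_hasLocalDecomposition_codewords hm hinj C C' hC hC'
    (le_max_left _ _) (le_max_right _ _)
  obtain ⟨e⟩ : Nonempty (Fin n ⊕ (Fin (max C.size C'.size) ⊕ Unit) ↪ Fin a) :=
    Function.Embedding.nonempty_of_card_le (by simpa using by omega)
  let g := (lowQubit n hk).sumMap e
  refine ⟨liftOperator g P, hP.lift g, ?_⟩
  have zero_comp : (fun _ => false) ∘ g = workspaceState _ (fun _ => false) fun _ => false := by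
    funext q
    rcases q with q | q | q <;> rfl
  rw [sum_monomialState_smul hk, liftOperator_mulVec_ket, zero_comp, P_ket]
  simp only [Pi.smul_apply, Finset.sum_apply, smul_assoc, Finset.sum_smul]
  rw [← Finset.smul_sum, Finset.sum_comm]
  simp only [sum_ket_smul, g, extend_lowQubit]

end Preparation

/-! ### Measuring the transformed state -/

section Measurement

variable {n k a : ℕ}

theorem ofBits_encodeQudits (r : Fin n → Fin (k + 1)) (i : Fin n) :
    Nat.ofBits (fun q : Fin k.size => encodeQudits n k a r (Sum.inl (i, q))) = r i :=
  ofBits_binary ((r i).is_le.trans_lt (Nat.lt_size_self k))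

theorem encodeQudits_injective : Function.Injective (encodeQudits n k a) := fun r s hrs =>
  funext fun i => Fin.ext <| by rw [← ofBits_encodeQudits (a := a), hrs, ofBits_encodeQudits]

theorem outcome_encodeQudits (r : Fin n → Fin (k + 1)) :
    outcome n k a (encodeQudits n k a r) = fun i => (k : ℤ) - 2 * (r i : ℕ) := by
  funext i
  rw [outcome, ofBits_encodeQudits]

theorem levels_injective :
    Function.Injective fun (r : Fin n → Fin (k + 1)) i => (k : ℤ) - 2 * (r i : ℕ) :=
  fun r r' hr => funext fun i => Fin.ext (by simpa using congrFun hr i)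

theorem exists_eq_of_squashedProb_ne_zero {Q : MvPolynomial (Fin n) ℝ} {y : Fin n → ℤ}
    (hy : squashedProb k Q y ≠ 0) :
    ∃ r : Fin n → Fin (k + 1), (fun i => (k : ℤ) - 2 * (r i : ℕ)) = y := by
  have orbitSize_ne_zero (i : Fin n) : orbitSize k (y i) ≠ 0 := fun hi => hy <| by
    rw [squashedProb, Finset.prod_eq_zero (Finset.mem_univ i) (by simp [hi]), mul_zero, zero_div]
  choose r hr using fun i => exists_eq_sub_two_mul_of_orbitSize_ne_zero (orbitSize_ne_zero i)
  exact ⟨r, funext fun i => (hr i).symm⟩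

theorem sum_norm_sq_sum_smul_ket {ι κ : Type*} [Fintype ι] [DecidableEq ι] [Fintype κ]
    {E : κ → ι → Bool} (hE : Function.Injective E) (c : κ → ℂ) (p : (ι → Bool) → Prop)
    [DecidablePred p] :
    ∑ x with p x, ‖(∑ r, c r • ket (E r)) x‖ ^ 2 = ∑ r with p (E r), ‖c r‖ ^ 2 := by
  classical
  refine (Finset.sum_of_injOn E hE.injOn (fun r hr => by simpa using hr) (fun x hpx hx => ?_)
    fun r _ => ?_).symm
  · have ne (r : κ) : x ≠ E r := fun h => hx ⟨r, by simpa [h] using hpx, h.symm⟩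
    simp [ket, ne]
  · simp [ket, Pi.single_apply, hE.eq_iff]

theorem outcomeProb_eq_squashedProb {Q : MvPolynomial (Fin n) ℝ}
    {A : Matrix ((Fin n × Fin k.size) ⊕ Fin a → Bool) ((Fin n × Fin k.size) ⊕ Fin a → Bool) ℂ}
    {c : (Fin n → Fin (k + 1)) → ℂ}
    (hA : A *ᵥ ket (fun _ => false) = ∑ r, c r • ket (encodeQudits n k a r))
    (hc : ∀ r, ‖c r‖ ^ 2 = squashedProb k Q fun j => (k : ℤ) - 2 * (r j : ℕ)) (y : Fin n → ℤ) :
    outcomeProb n k a A y = squashedProb k Q y := by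
  rw [outcomeProb, hA, sum_norm_sq_sum_smul_ket encodeQudits_injective]
  simp only [outcome_encodeQudits, hc]
  have sum_eq : ∑ r : Fin n → Fin (k + 1) with (fun i => (k : ℤ) - 2 * (r i : ℕ)) = y,
      squashedProb k Q (fun i => (k : ℤ) - 2 * (r i : ℕ)) =
        ∑ r : Fin n → Fin (k + 1) with (fun i => (k : ℤ) - 2 * (r i : ℕ)) = y,
          squashedProb k Q y :=
    Finset.sum_congr rfl fun r hr => congrArg _ (Finset.mem_filter.1 hr).2
  rw [sum_eq, Finset.sum_const]
  by_cases hy : squashedProb k Q y = 0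
  · rw [hy, smul_zero]
  · obtain ⟨r, rfl⟩ := exists_eq_of_squashedProb_ne_zero hy
    simp [levels_injective.eq_iff, Finset.filter_eq']

end Measurement

theorem exists_sampling_circuit {n m k d b sV a₀ : ℕ} {Q : MvPolynomial (Fin n) ℝ}
    {h : Fin m → Fin n → Bool} (hQ : IsSpecifiedBy Q h) (hm : 0 < m) (hd : 0 < d)
    (hhom : Q.IsHomogeneous d) (hk : 0 < k) {C C' : BoolCircuit n n}
    (hC : ∀ z : Fin m, C.eval (binary n z) = h z) (hC' : ∀ z : Fin m, C'.eval (h z) = binary n z)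
    {A : Matrix (Fin k.size ⊕ Fin a₀ → Bool) (Fin k.size ⊕ Fin a₀ → Bool) ℂ}
    (hA : HasLocalDecomposition b sV A) (hV : Implements (encodeQudit k a₀) (squashedQFT k) A)
    {a : ℕ} (ha₀ : a₀ ≤ a) (ha : n + max C.size C'.size < a) :
    ∃ P W, HasLocalDecomposition 3 (3 * n + 2 * C.size + 2 * C'.size) P ∧
      HasLocalDecomposition b (n * sV) W ∧
      P *ᵥ ket (fun _ => false) = ∑ r, monomialState k h r • ket (encodeQudits n k a r) ∧
      Implements (encodeQudits n k a) (tensorPower n (squashedQFT k)) W ∧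
      ∀ y, outcomeProb n k a (W * P) y = squashedProb k Q y := by
  obtain ⟨P, hP, P_ket⟩ := exists_hasLocalDecomposition_monomialState hk hm hQ.1 C C' hC hC' ha
  obtain ⟨W, hW, W_implements⟩ :=
    hV.exists_tensorPower (extend_registerEmbedding (n := n) ha₀) hA
  refine ⟨P, W, hP, hW, P_ket, W_implements, outcomeProb_eq_squashedProb ?_
    (hQ.norm_sq_tensorPower_mulVec_monomialState hhom hd hk)⟩
  rw [← Matrix.mulVec_mulVec, P_ket, W_implements.mulVec_sum]

theorem mainTheorem5 {I : Type*} (n m k d : I → ℕ)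
    (Q : ∀ i, MvPolynomial (Fin (n i)) ℝ)
    (h : ∀ i, Fin (m i) → Fin (n i) → Bool)
    (hQ : ∀ i, IsSpecifiedBy (Q i) (h i))
    (hm : ∀ i, 0 < m i)
    (hd : ∀ i, 0 < d i)
    (hhom : ∀ i, (Q i).IsHomogeneous (d i))
    (hk : ∀ i, 0 < k i) :
    (∀ i, squashedQFT (k i) ∈ Matrix.unitaryGroup (Fin (k i + 1)) ℂ) ∧
    (∀ i (r : Fin (n i) → Fin (k i + 1)),
      ‖(tensorPower (n i) (squashedQFT (k i)) *ᵥ monomialState (k i) (h i)) r‖ ^ 2 =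
        squashedProb (k i) (Q i) (fun j => (k i : ℤ) - 2 * (r j : ℕ))) ∧
    (EfficientlyInvertible n m h →
      (∃ p : Polynomial ℕ, ∀ i, k i ≤ 2 ^ p.eval (n i)) →
      SquashedQFTEfficient n k →
      ∃ (b : ℕ) (p : Polynomial ℕ), ∀ i, ∃ a ≤ p.eval (n i),
        ∃ P W : Matrix ((Fin (n i) × Fin (k i).size) ⊕ Fin a → Bool)
            ((Fin (n i) × Fin (k i).size) ⊕ Fin a → Bool) ℂ,
          HasLocalDecomposition b (p.eval (n i)) P ∧
          HasLocalDecomposition b (p.eval (n i)) W ∧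
          P *ᵥ ket (fun _ => false) =
            ∑ r, monomialState (k i) (h i) r • ket (encodeQudits (n i) (k i) a r) ∧
          Implements (encodeQudits (n i) (k i) a)
            (tensorPower (n i) (squashedQFT (k i))) W ∧
          ∀ y : Fin (n i) → ℤ,
            outcomeProb (n i) (k i) a (W * P) y = squashedProb (k i) (Q i) y) := by
  refine ⟨fun i => squashedQFT_mem_unitaryGroup (k i), fun i =>
    (hQ i).norm_sq_tensorPower_mulVec_monomialState (hhom i) (hd i) (hk i), ?_⟩
  rintro ⟨pC, hC⟩ - ⟨b, pV, hV⟩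
  refine ⟨max b 3, pV + Polynomial.X * pV + 3 * Polynomial.X + 4 * pC + 1, fun i => ?_⟩
  obtain ⟨C, C', size_le, size_le', eval_C, eval_C'⟩ := hC i
  obtain ⟨a₀, ha₀, A, hA, A_implements⟩ := hV i
  have eval_eq : (pV + Polynomial.X * pV + 3 * Polynomial.X + 4 * pC + 1).eval (n i) =
      pV.eval (n i) + n i * pV.eval (n i) + 3 * n i + 4 * pC.eval (n i) + 1 := by simp
  obtain ⟨P, W, hP, hW, circuit_spec⟩ := exists_sampling_circuit (hQ i) (hm i) (hd i) (hhom i)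
    (hk i) eval_C eval_C' hA A_implements (a := a₀ + (n i + max C.size C'.size + 1))
    (Nat.le_add_right _ _) (by omega)
  exact ⟨_, by omega, P, W, hP.mono (le_max_right _ _) (by omega),
    hW.mono (le_max_left _ _) (by omega), circuit_spec⟩
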